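/- Let $m\ge 1$, $n,r,s\ge 0$ be integers and let $F$ be a field of characteristic different from $2$ containing a primitive $2^{m+1}$-th root of unity. Fix primitive roots of unity $\rho_m,\rho_{m-1}\in F$ of orders $2^m$ and $2^{m-1}$. For $k\in\{m-1,m\}$ and $\alpha,\beta\in F^\times$ let $$(\alpha,\beta)_{2^k,F}=F\langle i,j : i^{2^k}=\alpha,\ j^{2^k}=\beta,\ ji=\rho_k\, ij\rangle,$$ a cyclic algebra of degree $2^k$. For $a=(a_1,\dots,a_{2n})\in (F^\times)^{2n}$ put $$C_m(a)=(a_1,a_2)_{2^m,F}\otimes\cdots\otimes(a_{2n-1},a_{2n})_{2^m,F}.$$ Let $B$ be the set of all $(b_1,\dots,b_{2n+2})\in(F^\times)^{2n+2}$ with $\prod_i b_i\in (F^\times)^2$. Define $\phi:(F^\times)^{2n}\to B$ by $\phi(a)=(b_1,\dots,b_{2n+2})$, where $b_1=1$, $b_{2n+2}=\prod_{j=1}^{2n}a_j$ and, for $1\le i\le n$, $$b_{2i}=a_{2i-1}\prod_{j=1}^{2i-1}b_j^{-1},\qquad b_{2i+1}=a_{2i}\prod_{j=1}^{2i-1}b_j^{-1}.$$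 Define $\psi:B\to(F^\times)^{2n}$ by $\psi(b)=(a_1,\dots,a_{2n})$, where, for $1\le i\le n$, $$a_{2i-1}=b_{2i}\prod_{j=1}^{2i-1}b_j,\qquad a_{2i}=b_{2i+1}\prod_{j=1}^{2i-1}b_j.$$ Consider the undirected graph on $(F^\times)^{2n+2}$ with the following edges. A tuple $b$ is joined to $b'$ by a full edge if for some index $i$ and some $c\in F^\times$ one has $b'_i=c^2b_i$ and $b'_k=b_k$ for all $k\ne i$. A tuple $b$ is joined to $b'$ by a dashed edge if for some $i<j$ one has $b'_i=(1+\tfrac{b_j}{b_i})b_i$, $b'_j=(1+\tfrac{b_j}{b_i})b_j$ and $b'_k=b_k$ for all $k\neq i,j$. A step is the passage along one edge (full or dashed, in either direction). **Theorem.** Let $v\in (F^\times)^{2n}$. Suppose that $\phi(v)$ is connected by $r$ steps to a tuple $w\in B$ such that $C_m(\psi(w))$ is Brauer equivalent to a tensor product of $s$ cyclic algebras $(\alpha,\beta)_{2^{m-1},F}$ of degree $2^{m-1}$. Then the class of $C_m(v)$ lies in ${}_{2^{m-1}}\mathrm{Br}(F)$, the subgroup of classes killed by $2^{m-1}$, and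 its symbol length there is at most $r+s$: $C_m(v)$ is Brauer equivalent to a tensor product of at most $r+s$ cyclic algebras $(\alpha,\beta)_{2^{m-1},F}$ of degree $2^{m-1}$. -/

import Mathlib

open scoped TensorProduct

/-! ### Symbol algebras, tensor products and Brauer equivalence -/

/-- The defining relations of the symbol algebra, on the free algebra with generators
`i = ι 0` and `j = ι 1`. -/
inductive SymbolRel {F : Type*} [Field F] (r : ℕ) (ρ α β : F) :
    FreeAlgebra F (Fin 2) → FreeAlgebra F (Fin 2) → Prop
  | pow_i : SymbolRel r ρ α β
      (FreeAlgebra.ι F 0 ^ r) (algebraMap F (FreeAlgebra F (Fin 2)) α)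
  | pow_j : SymbolRel r ρ α β
      (FreeAlgebra.ι F 1 ^ r) (algebraMap F (FreeAlgebra F (Fin 2)) β)
  | comm : SymbolRel r ρ α β
      (FreeAlgebra.ι F 1 * FreeAlgebra.ι F 0)
      (ρ • (FreeAlgebra.ι F 0 * FreeAlgebra.ι F 1))

/-- The cyclic (symbol) algebra `(α, β)_{r,F} = F⟨i, j : i ^ r = α, j ^ r = β, j i = ρ i j⟩`.
For `ρ` a primitive `r`-th root of unity it is a cyclic algebra of degree `r`. -/
def SymbolAlgebra {F : Type*} [Field F] (r : ℕ) (ρ : F) (α β : Fˣ) : Type _ :=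
  RingQuot (SymbolRel r ρ (α : F) (β : F))

noncomputable instance SymbolAlgebra.instRing {F : Type*} [Field F] (r : ℕ) (ρ : F) (α β : Fˣ) :
    Ring (SymbolAlgebra r ρ α β) :=
  inferInstanceAs (Ring (RingQuot (SymbolRel r ρ (α : F) (β : F))))

noncomputable instance SymbolAlgebra.instAlgebra {F : Type*} [Field F] (r : ℕ) (ρ : F)
    (α β : Fˣ) : Algebra F (SymbolAlgebra r ρ α β) :=
  inferInstanceAs (Algebra F (RingQuot (SymbolRel r ρ (α : F) (β : F))))

/-- Brauer equivalence of `F`-algebras: `M_p(A) ≅ M_q(B)` as `F`-algebras for some `p, q ≥ 1`. -/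
def BrauerEquivalent (F : Type*) [Field F] (A B : Type*) [Ring A] [Algebra F A]
    [Ring B] [Algebra F B] : Prop :=
  ∃ p q : ℕ, p ≠ 0 ∧ q ≠ 0 ∧
    Nonempty (Matrix (Fin p) (Fin p) A ≃ₐ[F] Matrix (Fin q) (Fin q) B)

/-- On central simple algebras this is the relation which defines Mathlib's `BrauerGroup F`. -/
theorem brauerEquivalent_iff_isBrauerEquivalent {F : Type*} [Field F] (A B : CSA F) :
    BrauerEquivalent F A B ↔ IsBrauerEquivalent A B :=
  Iff.rfl

/-- `A` is Brauer equivalent to a tensor product of exactly `t` cyclic algebras of degree `r`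
(for `t = 0` the tensor product is `F`). -/
def IsProductOfSymbols {F : Type*} [Field F] (r : ℕ) (ρ : F) (A : Type*) [Ring A] [Algebra F A]
    (t : ℕ) : Prop :=
  ∃ α β : Fin t → Fˣ, BrauerEquivalent F A (⨂[F] i, SymbolAlgebra r ρ (α i) (β i))

/-- The Brauer class of `A` is killed by `r`: the `r`-fold tensor power of `A` is split. -/
def InBrauerTorsion (F : Type*) [Field F] (r : ℕ) (A : Type*) [Ring A] [Algebra F A] : Prop :=
  BrauerEquivalent F (⨂[F] _i : Fin r, A) F

/-- The symbol length of (the class of) `A` with respect to symbols of degree `r`: the least `t`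
such that `A` is Brauer equivalent to a tensor product of `t` cyclic algebras of degree `r`,
and `⊤` if there is no such `t`. -/
noncomputable def symbolLength {F : Type*} [Field F] (r : ℕ) (ρ : F) (A : Type*) [Ring A]
    [Algebra F A] : ℕ∞ :=
  ⨅ (t : ℕ) (_ : IsProductOfSymbols r ρ A t), (t : ℕ∞)

/-! ### The graph on tuples -/

/-- A full edge: one slot is multiplied by a nonzero square. -/
def FullStep {F : Type*} [Field F] {N : ℕ} (a b : Fin N → Fˣ) : Prop :=
  ∃ (i : Fin N) (c : Fˣ), (∀ k, k ≠ i → a k = b k) ∧ b i = c ^ 2 * a i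

/-- A dashed edge: for some `i < j`, both slots `i` and `j` are multiplied by `1 + a_j / a_i`
(which is nonzero, since the entries of `b` are). -/
def DashedStep {F : Type*} [Field F] {N : ℕ} (a b : Fin N → Fˣ) : Prop :=
  ∃ i j : Fin N, i < j ∧ (∀ k, k ≠ i → k ≠ j → a k = b k) ∧
    (b i : F) = (1 + (a j : F) / (a i : F)) * (a i : F) ∧
    (b j : F) = (1 + (a j : F) / (a i : F)) * (a j : F)

/-- Adjacency in the (undirected) graph: the two tuples are connected by a full or a dashed
edge, traversed in either direction. -/
def ChainStep {F : Type*} [Field F] {N : ℕ} (a b : Fin N → Fˣ) : Prop :=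
  (FullStep a b ∨ FullStep b a) ∨ (DashedStep a b ∨ DashedStep b a)

/-- `a` is connected to `b` by a chain of exactly `r` steps. -/
def JoinedBySteps {F : Type*} [Field F] {N : ℕ} (r : ℕ) (a b : Fin N → Fˣ) : Prop :=
  ∃ u : ℕ → Fin N → Fˣ, u 0 = a ∧ u r = b ∧ ∀ i < r, ChainStep (u i) (u (i + 1))

/-! ### The maps `φ` and `ψ` -/

/-- The set `B` of `(2n+2)`-tuples of nonzero elements whose product is a square. -/
abbrev SquareTuple (F : Type*) [Field F] (n : ℕ) : Type _ :=
  {b : Fin (2 * n + 2) → Fˣ // IsSquare (∏ i, b i)}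

/-- The entries of `φ(a)`, with indices shifted by one: `phiEntry a k` is `b_{k+1}`.
Thus `b_1 = 1`; both `b_{2i}` and `b_{2i+1}` (`1 ≤ i ≤ n`) are the entry of `a` with index one
less, divided by `b_1 ⋯ b_{2i-1}`; and `b_{2n+2} = a_1 ⋯ a_{2n}`. -/
noncomputable def phiEntry {F : Type*} [Field F] {n : ℕ} (a : Fin (2 * n) → Fˣ) : ℕ → Fˣ
  | 0 => 1
  | k + 1 =>
    if h : k < 2 * n then a ⟨k, h⟩ * ∏ j : Fin (2 * (k / 2) + 1), (phiEntry a j)⁻¹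
    else ∏ j, a j
  decreasing_by have := j.2; omega

theorem isSquare_prod_phiEntry {F : Type*} [Field F] {n : ℕ} (a : Fin (2 * n) → Fˣ) :
    IsSquare (∏ i : Fin (2 * n + 2), phiEntry a i) := by
  have e0 : phiEntry a 0 = 1 := by rw [phiEntry]
  have key : ∀ i ≤ n, IsSquare ((∏ j ∈ Finset.range (2 * i + 1), phiEntry a j) *
      ∏ j ∈ Finset.range (2 * i), (if h : j < 2 * n then a ⟨j, h⟩ else 1)) := by
    intro i
    induction i with
    | zero => intro _; simp [e0]
    | succ i ih =>
      intro hi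
      obtain ⟨y, hy⟩ := ih (by omega)
      have e1 : phiEntry a (2 * i + 1) = a ⟨2 * i, by omega⟩ *
          (∏ j ∈ Finset.range (2 * i + 1), phiEntry a j)⁻¹ := by
        rw [phiEntry, dif_pos (by omega), Finset.prod_inv_distrib,
          Fin.prod_univ_eq_prod_range (fun j => phiEntry a j),
          show 2 * (2 * i / 2) = 2 * i by omega]
      have e2 : phiEntry a (2 * i + 1 + 1) = a ⟨2 * i + 1, by omega⟩ *
          (∏ j ∈ Finset.range (2 * i + 1), phiEntry a j)⁻¹ := by
        rw [phiEntry, dif_pos (by omega), Finset.prod_inv_distrib,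
          Fin.prod_univ_eq_prod_range (fun j => phiEntry a j),
          show 2 * ((2 * i + 1) / 2) = 2 * i by omega]
      have d1 : (if h : 2 * i < 2 * n then a ⟨2 * i, h⟩ else 1) = a ⟨2 * i, by omega⟩ :=
        dif_pos _
      have d2 : (if h : 2 * i + 1 < 2 * n then a ⟨2 * i + 1, h⟩ else 1) =
          a ⟨2 * i + 1, by omega⟩ := dif_pos _
      rw [show 2 * (i + 1) + 1 = 2 * i + 1 + 1 + 1 by ring,
        Finset.prod_range_succ _ (2 * i + 1 + 1), Finset.prod_range_succ _ (2 * i + 1), e1, e2]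
      generalize (∏ j ∈ Finset.range (2 * i + 1), phiEntry a j) = P at hy ⊢
      rw [show 2 * (i + 1) = 2 * i + 1 + 1 by ring, Finset.prod_range_succ _ (2 * i + 1),
        Finset.prod_range_succ _ (2 * i), d1, d2]
      generalize (∏ j ∈ Finset.range (2 * i), (if h : j < 2 * n then a ⟨j, h⟩ else 1)) = Q at hy ⊢
      refine ⟨a ⟨2 * i, by omega⟩ * a ⟨2 * i + 1, by omega⟩ * P⁻¹ * y, ?_⟩
      have hQ : Q = P⁻¹ * (y * y) := by rw [← hy]; simp
      rw [hQ]
      generalize a ⟨2 * i, _⟩ = x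
      generalize a ⟨2 * i + 1, _⟩ = z
      apply Units.ext
      push_cast
      field_simp
  have hn := key n le_rfl
  rw [Fin.prod_univ_eq_prod_range (fun j => phiEntry a j), Finset.prod_range_succ]
  have e3 : phiEntry a (2 * n + 1) =
      ∏ j ∈ Finset.range (2 * n), (if h : j < 2 * n then a ⟨j, h⟩ else 1) := by
    rw [phiEntry, dif_neg (by omega), ← Fin.prod_univ_eq_prod_range]
    simp
  rwa [e3]

/-- The map `φ : A → B`. -/
noncomputable def phi {F : Type*} [Field F] {n : ℕ} (a : Fin (2 * n) → Fˣ) : SquareTuple F n :=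
  ⟨fun k => phiEntry a k, isSquare_prod_phiEntry a⟩

/-- The map `ψ : B → A`. In one-based indices `a_{2i-1} = b_{2i} b_1 ⋯ b_{2i-1}` and
`a_{2i} = b_{2i+1} b_1 ⋯ b_{2i-1}` for `1 ≤ i ≤ n`; here the entry with zero-based index `k` is
`a_{k+1}`, so that `2i - 1 = 2 ⌊k/2⌋ + 1`. -/
def psi {F : Type*} [Field F] {n : ℕ} (b : SquareTuple F n) : Fin (2 * n) → Fˣ :=
  fun k => b.1 ⟨k + 1, by omega⟩ * ∏ j : Fin (2 * (k / 2) + 1), b.1 ⟨j, by omega⟩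

/-- `C_m(a_1, …, a_{2n}) = (a_1, a_2)_{2^m,F} ⊗ ⋯ ⊗ (a_{2n-1}, a_{2n})_{2^m,F}`. -/
abbrev CliffordTensor {F : Type*} [Field F] (m : ℕ) (ρ : F) {n : ℕ} (a : Fin (2 * n) → Fˣ) :
    Type _ :=
  ⨂[F] i : Fin n, SymbolAlgebra (2 ^ m) ρ (a ⟨2 * i, by omega⟩) (a ⟨2 * i + 1, by omega⟩)

/-! ### The monoid of Brauer equivalence classes of algebras -/

namespace BrauerEquivalent

variable {F : Type*} [Field F] {A B C D : Type*} [Ring A] [Algebra F A] [Ring B] [Algebra F B]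
  [Ring C] [Algebra F C] [Ring D] [Algebra F D]

/-! Write (α, β) for the class of a symbol algebra of degree 2^m. It is bimultiplicative and
satisfies the Steinberg relation. A 2^(m+1)-th root of unity makes -1 a 2^m-th power, so also (a, a)
= (a, -1) = 1. For a tuple b let P_k = b_1 ⋯ b_k and I(b) = ∏ (b_{2i} P_{2i-1}, b_{2i+1} P_{2i-1}).
This is the class of C_m(ψ(b)), and ψ ∘ φ = id, so I(φ(v)) is the class of C_m(v).

The heart is the behaviour of I along an edge. Multiplying b_i by u, for i ≤ 2n+1, multiplies I by
(u, t² P_{2n+1} b_i) for some t (`cliffordInvariant_change`); I does not see b_{2n+2}. On a full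
edge u is a square, and the exponent 2 moves to the other slot. On a dashed edge u = 1 + b_j/b_i,
and Steinberg gives (u, b_i) = (u, b_j), so the two changes combine to a symbol with a square slot.
If j is the last slot there is only one change, and squareness of the product of all entries plays
the same role. Hence every edge, in either direction, costs one symbol (x, y²).

Such a symbol has the class of a symbol of degree 2^(m-1) (`symbolClass_sq_right`). Thus r edges and
the s given symbols express C_m(v) by r + s symbols of degree 2^(m-1), each killed by 2^(m-1).

Central simplicity is never needed: classes of all algebras form a commutative monoid, symbols are
invertible in it by bimultiplicativity, and the isomorphisms come from dimension counts. -/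

theorem of_algEquiv (e : A ≃ₐ[F] B) : BrauerEquivalent F A B :=
  ⟨1, 1, one_ne_zero, one_ne_zero, ⟨e.mapMatrix⟩⟩

theorem refl (A : Type*) [Ring A] [Algebra F A] : BrauerEquivalent F A A :=
  of_algEquiv AlgEquiv.refl

theorem symm (h : BrauerEquivalent F A B) : BrauerEquivalent F B A :=
  let ⟨p, q, hp, hq, ⟨e⟩⟩ := h
  ⟨q, p, hq, hp, ⟨e.symm⟩⟩

open Matrix in
theorem trans (hAB : BrauerEquivalent F A B) (hBC : BrauerEquivalent F B C) :
    BrauerEquivalent F A C := by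
  obtain ⟨n, m, hn, hm, ⟨e₁⟩⟩ := hAB
  obtain ⟨p, q, hp, hq, ⟨e₂⟩⟩ := hBC
  -- M_p(M_n(A)) ≅ M_p(M_m(B)) ≅ M_m(M_p(B)) ≅ M_m(M_q(C)).
  exact ⟨p * n, m * q, mul_ne_zero hp hn, mul_ne_zero hm hq,
    ⟨reindexAlgEquiv _ _ finProdFinEquiv |>.symm.trans <| compAlgEquiv _ _ _ _|>.symm.trans <|
    e₁.mapMatrix (m := Fin p)|>.trans <| compAlgEquiv _ _ _ _|>.trans <|
    reindexAlgEquiv F B (.prodComm (Fin p) (Fin m))|>.trans <| compAlgEquiv _ _ _ _|>.symm.trans <|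
    e₂.mapMatrix.trans <| compAlgEquiv _ _ _ _|>.trans <| reindexAlgEquiv _ _ finProdFinEquiv⟩⟩

open Matrix in
theorem tensor (h : BrauerEquivalent F A B) (h' : BrauerEquivalent F C D) :
    BrauerEquivalent F (A ⊗[F] C) (B ⊗[F] D) := by
  obtain ⟨n, m, hn, hm, ⟨e₁⟩⟩ := h
  obtain ⟨p, q, hp, hq, ⟨e₂⟩⟩ := h'
  exact ⟨n * p, m * q, mul_ne_zero hn hp, mul_ne_zero hm hq,
    ⟨(reindexAlgEquiv F _ finProdFinEquiv).symm.trans <|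
      (kroneckerTMulAlgEquiv (Fin n) (Fin p) F F A C).symm.trans <|
      (Algebra.TensorProduct.congr e₁ e₂).trans <|
      (kroneckerTMulAlgEquiv (Fin m) (Fin q) F F B D).trans <|
      reindexAlgEquiv F _ finProdFinEquiv⟩⟩

theorem matrix {n : ℕ} (hn : n ≠ 0) (A : Type*) [Ring A] [Algebra F A] :
    BrauerEquivalent F (Matrix (Fin n) (Fin n) A) A :=
  ⟨1, n, one_ne_zero, hn, ⟨(Matrix.compAlgEquiv _ _ _ _).trans
    (Matrix.reindexAlgEquiv F A (Equiv.uniqueProd (Fin n) (Fin 1)))⟩⟩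

end BrauerEquivalent

/-- The tensor product of a family indexed by `Fin (n + 1)` splits off its first factor. -/
noncomputable def PiTensorProduct.consLinearEquiv (R : Type*) [CommRing R] {n : ℕ}
    (A : Fin (n + 1) → Type*) [∀ i, AddCommGroup (A i)] [∀ i, Module R (A i)] :
    (⨂[R] i, A i) ≃ₗ[R] A 0 ⊗[R] (⨂[R] i : Fin n, A i.succ) :=
  LinearEquiv.ofLinearMap
    (PiTensorProduct.lift (LinearMap.uncurryLeft
      { toFun := fun a => (TensorProduct.mk R _ _ a).compMultilinearMap (PiTensorProduct.tprod R)
        map_add' := fun a b => by ext; simp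
        map_smul' := fun a b => by ext; simp [TensorProduct.smul_tmul'] }))
    (TensorProduct.lift
      (PiTensorProduct.lift.toLinearMap ∘ₗ
        (PiTensorProduct.tprod R : MultilinearMap R A _).curryLeft))
    (by
      apply TensorProduct.ext'
      intro a x
      induction x using PiTensorProduct.induction_on with
      | smul_tprod r f =>
        simp [PiTensorProduct.lift.tprod]
      | add x y hx hy =>
        simp only [TensorProduct.tmul_add, map_add, hx, hy])
    (by ext f; simp [PiTensorProduct.lift.tprod])

noncomputable def PiTensorProduct.consAlgEquiv (R : Type*) [CommRing R] {n : ℕ}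
    (A : Fin (n + 1) → Type*) [∀ i, Ring (A i)] [∀ i, Algebra R (A i)] :
    (⨂[R] i, A i) ≃ₐ[R] A 0 ⊗[R] (⨂[R] i : Fin n, A i.succ) :=
  AlgEquiv.ofLinearEquiv (PiTensorProduct.consLinearEquiv R A)
    (by
      rw [PiTensorProduct.one_def, PiTensorProduct.consLinearEquiv]
      simp [PiTensorProduct.lift.tprod]
      rfl)
    (by
      apply LinearMap.map_mul_iff (PiTensorProduct.consLinearEquiv R A).toLinearMap |>.mpr
      ext x y
      simp [PiTensorProduct.lift.tprod, PiTensorProduct.consLinearEquiv]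
      rfl)

section BrauerMonoid

universe u

variable (F : Type u) [Field F]

/-- Brauer equivalence as a setoid on `F`-algebras. -/
def brauerSetoid : Setoid (AlgCat.{u} F) where
  r A B := BrauerEquivalent F A B
  iseqv := ⟨fun A => .refl A, .symm, .trans⟩

/-- Brauer equivalence classes of (arbitrary) `F`-algebras. -/
def BrauerMonoid : Type _ := Quotient (brauerSetoid F)

variable {F} in
/-- The class of an algebra. -/
def brauerClass (A : Type u) [Ring A] [Algebra F A] : BrauerMonoid F :=
  Quotient.mk (brauerSetoid F) (AlgCat.of F A)

variable {F} in
theorem brauerClass_eq_iff {A B : Type u} [Ring A] [Algebra F A] [Ring B] [Algebra F B] :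
    (brauerClass A : BrauerMonoid F) = brauerClass B ↔ BrauerEquivalent F A B :=
  Quotient.eq (r := brauerSetoid F)

/-- The product of Brauer classes is induced by the tensor product. -/
noncomputable instance : CommMonoid (BrauerMonoid F) where
  mul := Quotient.map₂ (sa := brauerSetoid F) (sb := brauerSetoid F) (sc := brauerSetoid F)
    (fun A B => AlgCat.of F (A ⊗[F] B)) fun _ _ h _ _ h' => BrauerEquivalent.tensor h h'
  one := brauerClass F
  mul_assoc := by
    rintro ⟨A⟩ ⟨B⟩ ⟨C⟩
    exact brauerClass_eq_iff.2 (.of_algEquiv (Algebra.TensorProduct.assoc F F F A B C))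
  one_mul := by
    rintro ⟨A⟩
    exact brauerClass_eq_iff.2 (.of_algEquiv (Algebra.TensorProduct.lid F A))
  mul_one := by
    rintro ⟨A⟩
    exact brauerClass_eq_iff.2 (.of_algEquiv (Algebra.TensorProduct.rid F F A))
  mul_comm := by
    rintro ⟨A⟩ ⟨B⟩
    exact brauerClass_eq_iff.2 (.of_algEquiv (Algebra.TensorProduct.comm F A B))

variable {F}

theorem brauerClass_self : (brauerClass F : BrauerMonoid F) = 1 := rfl

theorem brauerClass_tensor (A B : Type u) [Ring A] [Algebra F A] [Ring B] [Algebra F B] :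
    (brauerClass (A ⊗[F] B) : BrauerMonoid F) = brauerClass A * brauerClass B := rfl

theorem brauerClass_congr {A B : Type u} [Ring A] [Algebra F A] [Ring B] [Algebra F B]
    (e : A ≃ₐ[F] B) : (brauerClass A : BrauerMonoid F) = brauerClass B :=
  brauerClass_eq_iff.2 (.of_algEquiv e)

theorem brauerClass_matrix {n : ℕ} (hn : n ≠ 0) (A : Type u) [Ring A] [Algebra F A] :
    (brauerClass (Matrix (Fin n) (Fin n) A) : BrauerMonoid F) = brauerClass A :=
  brauerClass_eq_iff.2 (.matrix hn A)

theorem brauerClass_piTensorProduct {n : ℕ} (A : Fin n → Type u) [∀ i, Ring (A i)]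
    [∀ i, Algebra F (A i)] :
    (brauerClass (⨂[F] i, A i) : BrauerMonoid F) = ∏ i, brauerClass (A i) := by
  induction n with
  | zero =>
    rw [Fin.prod_univ_zero, ← brauerClass_self]
    refine brauerClass_congr (AlgEquiv.ofLinearEquiv
      (PiTensorProduct.isEmptyEquiv (R := F) (s := A) (Fin 0)) ?_ ?_)
    · exact PiTensorProduct.isEmptyEquiv_apply_tprod (R := F) (s := A) (ι := Fin 0) 1
    · apply LinearMap.map_mul_iff
        (PiTensorProduct.isEmptyEquiv (R := F) (s := A) (Fin 0)).toLinearMap |>.mpr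
      ext x y
      simp
  | succ n ih =>
    rw [Fin.prod_univ_succ, ← ih, ← brauerClass_tensor]
    exact brauerClass_congr (PiTensorProduct.consAlgEquiv F A)

end BrauerMonoid

/-! ### Pairs of elements satisfying the relations of a symbol algebra -/

/-- The relations of the standard generators of a symbol algebra. -/
structure IsSymbolPair {F D : Type*} [Field F] [Ring D] [Algebra F D] (r : ℕ) (ρ α β : F)
    (x y : D) : Prop where
  pow_left : x ^ r = algebraMap F D α
  pow_right : y ^ r = algebraMap F D β
  comm : y * x = ρ • (x * y)

namespace IsSymbolPair

variable {F D E : Type*} [Field F] [Ring D] [Algebra F D] [Ring E] [Algebra F E] {r : ℕ}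
  {ρ α β : F} {x y : D}

theorem map (h : IsSymbolPair r ρ α β x y) (f : D →ₐ[F] E) :
    IsSymbolPair r ρ α β (f x) (f y) where
  pow_left := by rw [← map_pow, h.pow_left, AlgHom.commutes]
  pow_right := by rw [← map_pow, h.pow_right, AlgHom.commutes]
  comm := by rw [← map_mul, h.comm, map_smul, map_mul]

theorem right_mul_left_pow (h : IsSymbolPair r ρ α β x y) (a : ℕ) :
    y * x ^ a = ρ ^ a • (x ^ a * y) := by
  induction a with
  | zero => simp
  | succ a ih =>
    rw [pow_succ, ← mul_assoc, ih, smul_mul_assoc, mul_assoc, h.comm, mul_smul_comm, smul_smul,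
      ← pow_succ, mul_assoc]

theorem right_pow_mul_left_pow (h : IsSymbolPair r ρ α β x y) (a b : ℕ) :
    y ^ b * x ^ a = ρ ^ (a * b) • (x ^ a * y ^ b) := by
  induction b with
  | zero => simp
  | succ b ih =>
    rw [pow_succ, mul_assoc, h.right_mul_left_pow, mul_smul_comm, ← mul_assoc, ih, smul_mul_assoc,
      smul_smul, mul_assoc, ← pow_add]
    congr 2
    ring

theorem isUnit_left (h : IsSymbolPair r ρ α β x y) (hr : r ≠ 0) (hα : α ≠ 0) : IsUnit x := by
  rw [← isUnit_pow_iff hr, h.pow_left]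
  exact (IsUnit.mk0 α hα).map (algebraMap F D)

theorem isUnit_right (h : IsSymbolPair r ρ α β x y) (hr : r ≠ 0) (hβ : β ≠ 0) : IsUnit y := by
  rw [← isUnit_pow_iff hr, h.pow_right]
  exact (IsUnit.mk0 β hβ).map (algebraMap F D)

open Module.End in
-- The y^b are eigenvectors of z ↦ x^(r-1) z x with the distinct eigenvalues α ρ^b.
theorem linearIndependent_right [Nontrivial D] (h : IsSymbolPair r ρ α β x y)
    (hρ : IsPrimitiveRoot ρ r) (hα : α ≠ 0) (hβ : β ≠ 0) :
    LinearIndependent F fun b : Fin r => y ^ (b : ℕ) := by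
  rcases r.eq_zero_or_pos with rfl | hr
  · exact linearIndependent_empty_type
  refine eigenvectors_linearIndependent'
    (LinearMap.mulLeft F (x ^ (r - 1)) * LinearMap.mulRight F x : Module.End F D)
    (fun b : Fin r => α * ρ ^ (b : ℕ)) ?_ _ ?_
  · intro a b hab
    exact Fin.ext (hρ.pow_inj a.2 b.2 (mul_left_cancel₀ hα hab))
  · intro b
    refine ⟨mem_eigenspace_iff.2 ?_, ((h.isUnit_right hr.ne' hβ).pow _).ne_zero⟩
    have := h.right_pow_mul_left_pow 1 b
    rw [pow_one, one_mul] at this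
    simp only [Module.End.mul_apply, LinearMap.mulLeft_apply, LinearMap.mulRight_apply]
    rw [this, mul_smul_comm, ← mul_assoc, pow_sub_one_mul hr.ne', h.pow_left,
      ← Algebra.smul_def, smul_smul, mul_comm]

open Module.End in
-- The operator z ↦ y z y^(r-1) has x^a y^b in its eigenspace for β ρ^a, so a relation splits
-- according to a. Cancelling the unit x^a leaves a relation among the powers of y.
theorem linearIndependent [Nontrivial D] (h : IsSymbolPair r ρ α β x y)
    (hρ : IsPrimitiveRoot ρ r) (hα : α ≠ 0) (hβ : β ≠ 0) :
    LinearIndependent F fun p : Fin r × Fin r => x ^ (p.1 : ℕ) * y ^ (p.2 : ℕ) := by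
  rcases r.eq_zero_or_pos with rfl | hr
  · exact linearIndependent_empty_type
  rw [Fintype.linearIndependent_iff]
  intro c hc
  have hind : iSupIndep fun a : Fin r =>
      eigenspace (LinearMap.mulLeft F y * LinearMap.mulRight F (y ^ (r - 1)) : Module.End F D)
        (β * ρ ^ (a : ℕ)) :=
    (eigenspaces_iSupIndep _).comp fun a b hab =>
      Fin.ext (hρ.pow_inj a.2 b.2 (mul_left_cancel₀ hβ hab))
  have key := (iSupIndep_iff_finsetSum_eq_zero_imp_eq_zero _).1 hind Finset.univ
    (fun a => ∑ b, c (a, b) • (x ^ (a : ℕ) * y ^ (b : ℕ)))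
    (by
      intro a _
      refine Submodule.sum_mem _ fun b _ => Submodule.smul_mem _ _ (mem_eigenspace_iff.2 ?_)
      simp only [Module.End.mul_apply, LinearMap.mulLeft_apply, LinearMap.mulRight_apply]
      rw [← mul_assoc, ← mul_assoc, h.right_mul_left_pow, mul_assoc, smul_mul_assoc,
        mul_assoc, ← pow_add, ← pow_succ', show (b : ℕ) + (r - 1) + 1 = b + r by omega, pow_add,
        h.pow_right, ← Algebra.commutes, ← Algebra.smul_def, mul_smul_comm, smul_smul, mul_comm])
    (by rw [← hc, Fintype.sum_prod_type])
  rintro ⟨a, b⟩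
  have hx := (h.isUnit_left hr.ne' hα).pow (a : ℕ)
  have h0 : ∑ b : Fin r, c (a, b) • y ^ (b : ℕ) = 0 := by
    refine (hx.mul_right_eq_zero).1 ?_
    rw [Finset.mul_sum, ← key a (Finset.mem_univ a)]
    exact Finset.sum_congr rfl fun b _ => mul_smul_comm _ _ _
  exact Fintype.linearIndependent_iff.1 (h.linearIndependent_right hρ hα hβ) _ h0 b

end IsSymbolPair

/-! ### Basic structure of symbol algebras -/

namespace SymbolAlgebra

variable {F : Type*} [Field F] {D : Type*} [Ring D] [Algebra F D] {r : ℕ} {ρ : F} {α β : Fˣ}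

variable (r ρ α β) in
/-- The first standard generator. -/
noncomputable def genI : SymbolAlgebra r ρ α β :=
  RingQuot.mkAlgHom F (SymbolRel r ρ (α : F) (β : F)) (FreeAlgebra.ι F 0)

variable (r ρ α β) in
/-- The second standard generator. -/
noncomputable def genJ : SymbolAlgebra r ρ α β :=
  RingQuot.mkAlgHom F (SymbolRel r ρ (α : F) (β : F)) (FreeAlgebra.ι F 1)

theorem isSymbolPair_gen : IsSymbolPair r ρ (α : F) (β : F) (genI r ρ α β) (genJ r ρ α β) where
  pow_left := by
    have := RingQuot.mkAlgHom_rel F (SymbolRel.pow_i (r := r) (ρ := ρ) (α := (α : F)) (β := (β : F)))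
    rwa [map_pow, AlgHom.commutes] at this
  pow_right := by
    have := RingQuot.mkAlgHom_rel F (SymbolRel.pow_j (r := r) (ρ := ρ) (α := (α : F)) (β := (β : F)))
    rwa [map_pow, AlgHom.commutes] at this
  comm := by
    have := RingQuot.mkAlgHom_rel F (SymbolRel.comm (r := r) (ρ := ρ) (α := (α : F)) (β := (β : F)))
    rwa [map_mul, map_smul, map_mul] at this

/-- The universal property of a symbol algebra. -/
noncomputable def lift {x y : D} (h : IsSymbolPair r ρ (α : F) (β : F) x y) :
    SymbolAlgebra r ρ α β →ₐ[F] D :=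
  RingQuot.liftAlgHom F ⟨FreeAlgebra.lift F ![x, y], by
    rintro _ _ (_ | _ | _)
    · simpa using h.pow_left
    · simpa using h.pow_right
    · simpa using h.comm⟩

@[simp]
theorem lift_genI {x y : D} (h : IsSymbolPair r ρ (α : F) (β : F) x y) :
    lift h (genI r ρ α β) = x := by
  refine (RingQuot.liftAlgHom_mkAlgHom_apply F _ _ _).trans ?_
  simp

@[simp]
theorem lift_genJ {x y : D} (h : IsSymbolPair r ρ (α : F) (β : F) x y) :
    lift h (genJ r ρ α β) = y := by
  refine (RingQuot.liftAlgHom_mkAlgHom_apply F _ _ _).trans ?_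
  simp

@[ext]
theorem algHom_ext {f g : SymbolAlgebra r ρ α β →ₐ[F] D}
    (hI : f (genI r ρ α β) = g (genI r ρ α β)) (hJ : f (genJ r ρ α β) = g (genJ r ρ α β)) :
    f = g := by
  refine RingQuot.ringQuot_ext' F f g (FreeAlgebra.hom_ext (funext fun k => ?_))
  fin_cases k
  · exact hI
  · exact hJ

/-- The span of the reduced monomials contains 1 and is stable under left multiplication by both
generators, hence by everything. -/
theorem mem_span_monomials (hr : r ≠ 0) (z : SymbolAlgebra r ρ α β) :
    z ∈ Submodule.span F (Set.range fun p : Fin r × Fin r =>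
      genI r ρ α β ^ (p.1 : ℕ) * genJ r ρ α β ^ (p.2 : ℕ)) := by
  have h : IsSymbolPair r ρ (α : F) (β : F) (genI r ρ α β) (genJ r ρ α β) := isSymbolPair_gen
  have hr' : 0 < r := Nat.pos_of_ne_zero hr
  set S := Submodule.span F (Set.range fun p : Fin r × Fin r =>
      genI r ρ α β ^ (p.1 : ℕ) * genJ r ρ α β ^ (p.2 : ℕ))
  have mono : ∀ a b : ℕ, genI r ρ α β ^ a * genJ r ρ α β ^ b ∈ S := by
    intro a b
    have : genI r ρ α β ^ a * genJ r ρ α β ^ b = ((α : F) ^ (a / r) * (β : F) ^ (b / r)) •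
        (genI r ρ α β ^ (a % r) * genJ r ρ α β ^ (b % r)) := by
      conv_lhs => rw [← Nat.div_add_mod a r, ← Nat.mod_add_div b r]
      rw [pow_add, pow_mul, h.pow_left, pow_add, pow_mul, h.pow_right, ← map_pow, ← map_pow,
        ← Algebra.commutes, ← Algebra.smul_def, ← Algebra.smul_def, smul_mul_smul_comm]
    rw [this]
    exact S.smul_mem _ (Submodule.subset_span
      ⟨(⟨a % r, Nat.mod_lt _ hr'⟩, ⟨b % r, Nat.mod_lt _ hr'⟩), rfl⟩)
  have stepI : ∀ z ∈ S, genI r ρ α β * z ∈ S := by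
    intro z hz
    induction hz using Submodule.span_induction with
    | mem _ hx =>
      obtain ⟨p, rfl⟩ := hx
      dsimp only
      rw [← mul_assoc, ← pow_succ']
      exact mono _ _
    | zero => rw [mul_zero]; exact S.zero_mem
    | add _ _ _ _ h₁ h₂ => rw [mul_add]; exact S.add_mem h₁ h₂
    | smul c _ _ h₁ => rw [mul_smul_comm]; exact S.smul_mem _ h₁
  have stepJ : ∀ z ∈ S, genJ r ρ α β * z ∈ S := by
    intro z hz
    induction hz using Submodule.span_induction with
    | mem _ hx =>
      obtain ⟨p, rfl⟩ := hx
      dsimp only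
      rw [← mul_assoc, h.right_mul_left_pow, smul_mul_assoc, mul_assoc, ← pow_succ']
      exact S.smul_mem _ (mono _ _)
    | zero => rw [mul_zero]; exact S.zero_mem
    | add _ _ _ _ h₁ h₂ => rw [mul_add]; exact S.add_mem h₁ h₂
    | smul c _ _ h₁ => rw [mul_smul_comm]; exact S.smul_mem _ h₁
  obtain ⟨z, rfl⟩ := RingQuot.mkAlgHom_surjective F (SymbolRel r ρ (α : F) (β : F)) z
  have key : ∀ w ∈ S, (show SymbolAlgebra r ρ α β from
      RingQuot.mkAlgHom F (SymbolRel r ρ (α : F) (β : F)) z) * w ∈ S := by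
    induction z using FreeAlgebra.induction with
    | grade0 c =>
      intro w hw
      rw [AlgHom.commutes]
      change algebraMap F (SymbolAlgebra r ρ α β) c * w ∈ S
      rw [← Algebra.smul_def]
      exact S.smul_mem _ hw
    | grade1 k =>
      fin_cases k
      · exact stepI
      · exact stepJ
    | mul a b ha hb =>
      intro w hw
      rw [map_mul]
      have := ha _ (hb _ hw)
      rwa [← mul_assoc] at this
    | add a b ha hb =>
      intro w hw
      rw [map_add]
      have := S.add_mem (ha _ hw) (hb _ hw)
      rwa [← add_mul] at this
  have h1 : (1 : SymbolAlgebra r ρ α β) ∈ S := by simpa using mono 0 0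
  have := key 1 h1
  rwa [mul_one (M := SymbolAlgebra r ρ α β)] at this

/-- This replaces simplicity of the symbol algebra: the images of the spanning monomials again form
a symbol pair, so they stay independent. -/
theorem injective_algHom [Nontrivial D] (hr : r ≠ 0) (hρ : IsPrimitiveRoot ρ r)
    (f : SymbolAlgebra r ρ α β →ₐ[F] D) : Function.Injective f := by
  rw [injective_iff_map_eq_zero]
  intro z hz
  obtain ⟨c, rfl⟩ := (Submodule.mem_span_range_iff_exists_fun F).1 (mem_span_monomials hr z)
  have hli := ((isSymbolPair_gen (r := r) (ρ := ρ) (α := α) (β := β)).map f).linearIndependent hρ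
    α.ne_zero β.ne_zero
  have := Fintype.linearIndependent_iff.1 hli c (by simpa [map_sum] using hz)
  simp [this]

end SymbolAlgebra

namespace IsSymbolPair

variable {F D E : Type*} [Field F] [Ring D] [Algebra F D] [Ring E] [Algebra F E] {r : ℕ}
  {ρ α β : F} {x y : D}

/-- Tensoring with an element of another algebra. -/
theorem tmul (h : IsSymbolPair r ρ α β x y) {α' : F} {z : E} (hz : z ^ r = algebraMap F E α') :
    IsSymbolPair r ρ (α * α') β (x ⊗ₜ[F] z) (y ⊗ₜ[F] (1 : E)) where
  pow_left := by
    rw [Algebra.TensorProduct.tmul_pow, h.pow_left, hz, Algebra.algebraMap_eq_smul_one,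
      Algebra.algebraMap_eq_smul_one, TensorProduct.smul_tmul_smul,
      ← Algebra.TensorProduct.one_def, ← Algebra.algebraMap_eq_smul_one]
  pow_right := by
    rw [Algebra.TensorProduct.tmul_pow, h.pow_right, one_pow]
    rfl
  comm := by
    rw [Algebra.TensorProduct.tmul_mul_tmul, Algebra.TensorProduct.tmul_mul_tmul, h.comm, one_mul,
      mul_one, TensorProduct.smul_tmul']

end IsSymbolPair

/-! ### The cyclic representation -/

section CyclicRepresentation

open Polynomial

variable {F : Type*} [Field F] {r : ℕ} {ρ : F}

/-- The substitution `X ↦ ρ⁻¹ X` on `F[X] / (X ^ r - β)`. -/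
noncomputable def rootTwist (hρ : ρ ^ r = 1) (β : F) :
    AdjoinRoot (X ^ r - C β) →ₐ[F] AdjoinRoot (X ^ r - C β) :=
  AdjoinRoot.liftAlgHom _ (Algebra.ofId F _) (ρ⁻¹ • AdjoinRoot.root (X ^ r - C β)) (by
    have h := AdjoinRoot.eval₂_root (X ^ r - C β)
    rw [eval₂_sub, eval₂_X_pow, eval₂_C] at h
    rw [eval₂_sub, eval₂_X_pow, eval₂_C, _root_.smul_pow, inv_pow, hρ, inv_one, one_smul]
    exact h)

theorem root_pow (β : F) : AdjoinRoot.root (X ^ r - C β) ^ r =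
    algebraMap F (AdjoinRoot (X ^ r - C β)) β := by
  have h := AdjoinRoot.eval₂_root (X ^ r - C β)
  rw [eval₂_sub, eval₂_X_pow, eval₂_C, sub_eq_zero] at h
  exact h

theorem rootTwist_pow_root (hρ : ρ ^ r = 1) (β : F) (k : ℕ) :
    (rootTwist hρ β ^ k) (AdjoinRoot.root (X ^ r - C β)) =
      (ρ⁻¹ ^ k) • AdjoinRoot.root (X ^ r - C β) := by
  induction k with
  | zero => simp
  | succ k ih =>
    rw [pow_succ', AlgHom.mul_apply, ih, map_smul, rootTwist, AdjoinRoot.liftAlgHom_root, smul_smul,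
      pow_succ]

/-- The split model of (1, β): the twist and multiplication by the root act on the r-dimensional
space F[X]/(X^r - β). -/
theorem isSymbolPair_rootTwist (hr : r ≠ 0) (hρ : ρ ^ r = 1) (β : F) :
    IsSymbolPair r ρ 1 β (rootTwist hρ β).toLinearMap
      (LinearMap.mulLeft F (AdjoinRoot.root (X ^ r - C β))) where
  pow_left := by
    have h : rootTwist hρ β ^ r = 1 := by
      apply AdjoinRoot.algHom_ext
      rw [rootTwist_pow_root, inv_pow, hρ, inv_one, one_smul, AlgHom.one_apply]
    rw [map_one]
    ext z
    have := DFunLike.congr_fun h z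
    rw [AlgHom.one_apply] at this
    rw [Module.End.one_apply]
    conv_rhs => rw [← this]
    rw [Module.End.pow_apply, AlgHom.coe_pow]
    rfl
  pow_right := by
    ext z
    rw [LinearMap.pow_mulLeft, LinearMap.mulLeft_apply, root_pow, ← Algebra.smul_def,
      Module.algebraMap_end_apply]
  comm := by
    have hρ0 : ρ ≠ 0 := by
      rintro rfl
      rw [zero_pow hr] at hρ
      exact zero_ne_one hρ
    ext z
    simp only [Module.End.mul_apply, LinearMap.mulLeft_apply, LinearMap.smul_apply,
      AlgHom.toLinearMap_apply, map_mul]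
    rw [← smul_mul_assoc, rootTwist, AdjoinRoot.liftAlgHom_root, smul_smul, mul_inv_cancel₀ hρ0,
      one_smul]

theorem finrank_adjoinRoot_X_pow_sub_C (hr : r ≠ 0) (β : F) :
    Module.finrank F (AdjoinRoot (X ^ r - C β)) = r := by
  rw [(AdjoinRoot.powerBasis (X_pow_sub_C_ne_zero (Nat.pos_of_ne_zero hr) β)).finrank,
    AdjoinRoot.powerBasis_dim, natDegree_X_pow_sub_C]

theorem finite_adjoinRoot_X_pow_sub_C (hr : r ≠ 0) (β : F) :
    Module.Finite F (AdjoinRoot (X ^ r - C β)) :=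
  (AdjoinRoot.powerBasis (X_pow_sub_C_ne_zero (Nat.pos_of_ne_zero hr) β)).finite

theorem nontrivial_adjoinRoot_X_pow_sub_C (hr : r ≠ 0) (β : F) :
    Nontrivial (AdjoinRoot (X ^ r - C β)) :=
  AdjoinRoot.nontrivial _ (by
    rw [degree_X_pow_sub_C (Nat.pos_of_ne_zero hr)]
    exact_mod_cast hr)

end CyclicRepresentation

/-! ### Dimension of symbol algebras and their recognition by generators. -/

namespace SymbolAlgebra

open Polynomial

variable {F : Type*} [Field F] {D : Type*} [Ring D] [Algebra F D] {r : ℕ} {ρ : F} {α β : Fˣ}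

/-- The presentation does not collapse because it has a nonzero model: in End(F[X]/(X^r - β)) ⊗
F[X]/(X^r - α), correct the split pair for (1, β) by an r-th root of α. -/
theorem nontrivial (hr : r ≠ 0) (hρ : ρ ^ r = 1) : Nontrivial (SymbolAlgebra r ρ α β) := by
  have := nontrivial_adjoinRoot_X_pow_sub_C hr (α : F)
  have := nontrivial_adjoinRoot_X_pow_sub_C hr (β : F)
  have h := (isSymbolPair_rootTwist hr hρ (β : F)).tmul (root_pow (r := r) (α : F))
  rw [one_mul] at h
  exact (lift h).toRingHom.domain_nontrivial

theorem finite (hr : r ≠ 0) : Module.Finite F (SymbolAlgebra r ρ α β) :=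
  ⟨Submodule.fg_def.2 ⟨_, Set.finite_range _, eq_top_iff.2 fun z _ => mem_span_monomials hr z⟩⟩

theorem finrank_eq (hr : r ≠ 0) (hρ : IsPrimitiveRoot ρ r) :
    Module.finrank F (SymbolAlgebra r ρ α β) = r * r := by
  have := nontrivial hr hρ.pow_eq_one (α := α) (β := β)
  have := Module.finrank_eq_card_basis (Module.Basis.mk
    (isSymbolPair_gen.linearIndependent hρ α.ne_zero β.ne_zero)
    (fun z _ => mem_span_monomials (r := r) (ρ := ρ) (α := α) (β := β) hr z))
  simpa using this

theorem bijective_algHom [Nontrivial D] (hr : r ≠ 0) (hρ : IsPrimitiveRoot ρ r)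
    (hD : Module.finrank F D = r * r) (f : SymbolAlgebra r ρ α β →ₐ[F] D) :
    Function.Bijective f := by
  have := finite (F := F) hr (ρ := ρ) (α := α) (β := β)
  have : Module.Finite F D := Module.finite_of_finrank_pos (by
    rw [hD]; exact Nat.mul_pos (Nat.pos_of_ne_zero hr) (Nat.pos_of_ne_zero hr))
  have hinj := injective_algHom hr hρ f
  exact ⟨hinj, (LinearMap.injective_iff_surjective_of_finrank_eq_finrank
    (f := f.toLinearMap) ((finrank_eq hr hρ).trans hD.symm)).1 hinj⟩

/-- An algebra of dimension `r ^ 2` with a pair of elements satisfying the relations of a symbol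
algebra is that symbol algebra. -/
noncomputable def equivOfPair [Nontrivial D] (hr : r ≠ 0) (hρ : IsPrimitiveRoot ρ r)
    (hD : Module.finrank F D = r * r) {x y : D} (h : IsSymbolPair r ρ (α : F) (β : F) x y) :
    SymbolAlgebra r ρ α β ≃ₐ[F] D :=
  AlgEquiv.ofBijective (lift h) (bijective_algHom hr hρ hD _)

theorem algHom_mem (hr : r ≠ 0) (f : SymbolAlgebra r ρ α β →ₐ[F] D) (S : Subalgebra F D)
    (hI : f (genI r ρ α β) ∈ S) (hJ : f (genJ r ρ α β) ∈ S) (z : SymbolAlgebra r ρ α β) :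
    f z ∈ S := by
  obtain ⟨c, rfl⟩ := (Submodule.mem_span_range_iff_exists_fun F).1 (mem_span_monomials hr z)
  rw [map_sum]
  refine S.sum_mem fun p _ => ?_
  rw [map_smul, map_mul, map_pow, map_pow]
  exact S.smul_mem (S.mul_mem (S.pow_mem hI _) (S.pow_mem hJ _)) _

end SymbolAlgebra

/-! ### Brauer classes of symbol algebras -/

theorem units_inv_pow_eq_algebraMap {F D : Type*} [Field F] [Ring D] [Algebra F D] {u : Dˣ}
    {r : ℕ} {α : F} (h : (u : D) ^ r = algebraMap F D α) :
    ((u⁻¹ : Dˣ) : D) ^ r = algebraMap F D α⁻¹ := by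
  cases subsingleton_or_nontrivial D
  · exact Subsingleton.elim _ _
  rw [← Units.val_pow_eq_pow_val] at h
  have hα : α ≠ 0 := by
    rintro rfl
    rw [map_zero] at h
    exact (u ^ r).ne_zero h
  rw [← Units.val_pow_eq_pow_val, inv_pow]
  apply Units.inv_eq_of_mul_eq_one_right
  rw [h, ← map_mul, mul_inv_cancel₀ hα, map_one]

namespace IsSymbolPair

variable {F D E : Type*} [Field F] [Ring D] [Algebra F D] [Ring E] [Algebra F E] {r : ℕ}
  {ρ α β : F} {x y : D}

theorem swap {u : Dˣ} (h : IsSymbolPair r ρ α β (u : D) y) :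
    IsSymbolPair r ρ β α⁻¹ y ((u⁻¹ : Dˣ) : D) where
  pow_left := h.pow_right
  pow_right := units_inv_pow_eq_algebraMap h.pow_left
  comm := by
    rw [Units.inv_mul_eq_iff_eq_mul, mul_smul_comm, ← mul_assoc, ← smul_mul_assoc, ← h.comm,
      mul_assoc, Units.mul_inv, mul_one]

theorem smul_left (h : IsSymbolPair r ρ α β x y) (c : F) :
    IsSymbolPair r ρ (c ^ r * α) β (c • x) y where
  pow_left := by rw [smul_pow, h.pow_left, map_mul, Algebra.smul_def]
  pow_right := h.pow_right
  comm := by rw [mul_smul_comm, h.comm, smul_mul_assoc, smul_comm]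

/-- Multiplying the first generator by a polynomial in the second one. -/
theorem mul_aeval_pow (h : IsSymbolPair r ρ α β x y) (p : Polynomial F) (n : ℕ) :
    (x * Polynomial.aeval y p) ^ n = x ^ n *
      Polynomial.aeval y (∏ k ∈ Finset.range n, p.comp (Polynomial.C (ρ ^ k) * Polynomial.X)) := by
  have comm : ∀ k : ℕ, Polynomial.aeval y p * x ^ k =
      x ^ k * Polynomial.aeval y (p.comp (Polynomial.C (ρ ^ k) * Polynomial.X)) := by
    intro k
    induction p using Polynomial.induction_on' with
    | add p q hp hq => simp only [map_add, Polynomial.add_comp, add_mul, mul_add, hp, hq]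
    | monomial n c =>
      rw [Polynomial.aeval_monomial, Polynomial.monomial_comp, map_mul, Polynomial.aeval_C, map_pow,
        map_mul, Polynomial.aeval_C, Polynomial.aeval_X, mul_assoc, h.right_pow_mul_left_pow,
        ← Algebra.smul_def, ← Algebra.smul_def, ← Algebra.smul_def, smul_pow, mul_smul_comm,
        mul_smul_comm, pow_mul]
  induction n with
  | zero => simp
  | succ n ih =>
    rw [pow_succ', ih, mul_assoc, ← mul_assoc (Polynomial.aeval y p), comm, Finset.prod_range_succ,
      mul_comm (∏ k ∈ Finset.range n, _), map_mul, pow_succ', mul_assoc, mul_assoc]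

/-- The polynomial in `hc` evaluates to the product of the conjugates p(ρ^k y), a norm of p(y). The
cases p = 1 - X and p = X give the Steinberg relation and (β, β) = 1. -/
theorem mul_aeval (h : IsSymbolPair r ρ α β x y) (p : Polynomial F) {c : F}
    (hc : Polynomial.aeval y
      (∏ k ∈ Finset.range r, p.comp (Polynomial.C (ρ ^ k) * Polynomial.X)) = algebraMap F D c) :
    IsSymbolPair r ρ (α * c) β (x * Polynomial.aeval y p) y where
  pow_left := by rw [h.mul_aeval_pow, hc, h.pow_left, map_mul]
  pow_right := h.pow_right
  comm := by
    have : Commute (Polynomial.aeval y p) y := by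
      simpa [Commute, SemiconjBy] using congrArg (Polynomial.aeval y) (mul_comm p Polynomial.X)
    rw [← mul_assoc, h.comm, smul_mul_assoc, mul_assoc, mul_assoc, this.eq]

/-- The block matrix is a square root of the scalar matrix x, and passing it across the diagonal
exchanges y and ρ y. This realises (α, β²) of degree 2M inside 2 × 2 matrices over (α, β) of degree
M. -/
theorem matrix {M : ℕ} (h : IsSymbolPair M (ρ ^ 2) α β x y) (hneg : ρ ^ M = -1) :
    IsSymbolPair (2 * M) ρ α (β ^ 2) !![0, x; 1, 0] (Matrix.diagonal ![y, ρ • y]) where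
  pow_left := by
    have h2 : !![0, x; 1, 0] ^ 2 = Matrix.diagonal ![x, x] := by
      rw [sq, Matrix.mul_fin_two]
      ext i j
      fin_cases i <;> fin_cases j <;> simp
    rw [pow_mul, h2, Matrix.diagonal_pow, Matrix.algebraMap_eq_diagonal]
    congr 1
    ext i
    fin_cases i <;> simp [h.pow_left]
  pow_right := by
    rw [Matrix.diagonal_pow, Matrix.algebraMap_eq_diagonal]
    congr 1
    ext i
    fin_cases i
    · simp [mul_comm 2 M, pow_mul, h.pow_right]
    · simp [mul_comm 2 M, pow_mul, h.pow_right, smul_pow, hneg]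
  comm := by
    ext i j
    fin_cases i <;> fin_cases j <;>
      simp [Matrix.vecMul_diagonal, h.comm, smul_smul, sq]

end IsSymbolPair

namespace SymbolAlgebra

variable {F D : Type*} [Field F] [Ring D] [Algebra F D] {r : ℕ} {ρ ρ' : F} {α β α' β' : Fˣ}

theorem commute_lift (hr : r ≠ 0) {x y x' y' : D} (h : IsSymbolPair r ρ (α : F) (β : F) x y)
    (h' : IsSymbolPair r ρ' (α' : F) (β' : F) x' y') (hxx : Commute x x') (hxy : Commute x y')
    (hyx : Commute y x') (hyy : Commute y y') (a : SymbolAlgebra r ρ α β)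
    (b : SymbolAlgebra r ρ' α' β') : Commute (lift h a) (lift h' b) := by
  have key : ∀ z : D, Commute z x' → Commute z y' → Commute z (lift h' b) := by
    intro z hx hy
    have := algHom_mem hr (lift h') (Subalgebra.centralizer F {z})
      (by simpa [Subalgebra.mem_centralizer_iff] using hx.eq)
      (by simpa [Subalgebra.mem_centralizer_iff] using hy.eq) b
    exact (Subalgebra.mem_centralizer_iff F).1 this _ rfl
  have := algHom_mem hr (lift h) (Subalgebra.centralizer F {lift h' b})
    (by simpa [Subalgebra.mem_centralizer_iff] using (key x hxx hxy).symm.eq)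
    (by simpa [Subalgebra.mem_centralizer_iff] using (key y hyx hyy).symm.eq) a
  have := (Subalgebra.mem_centralizer_iff F).1 this _ rfl
  exact this.symm

end SymbolAlgebra

section SymbolClass

universe u

variable {F : Type u} [Field F] {r : ℕ} {ρ : F}

/-- The Brauer class of a symbol algebra. -/
noncomputable def symbolClass (r : ℕ) (ρ : F) (α β : Fˣ) : BrauerMonoid F :=
  brauerClass (SymbolAlgebra r ρ α β)

theorem symbolClass_eq_of_pair {ρ' : F} {α β α' β' : Fˣ} (hr : r ≠ 0) (hρ : IsPrimitiveRoot ρ r)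
    (hρ' : IsPrimitiveRoot ρ' r) {x y : SymbolAlgebra r ρ' α' β'}
    (h : IsSymbolPair r ρ (α : F) (β : F) x y) :
    symbolClass r ρ α β = symbolClass r ρ' α' β' := by
  have := SymbolAlgebra.nontrivial hr hρ'.pow_eq_one (α := α') (β := β')
  exact brauerClass_congr (SymbolAlgebra.equivOfPair hr hρ (SymbolAlgebra.finrank_eq hr hρ') h)

/-- The split model has endomorphism algebra of dimension r², so the symbol algebra is all of it. -/
theorem symbolClass_one_left (hr : r ≠ 0) (hρ : IsPrimitiveRoot ρ r) (β : Fˣ) :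
    symbolClass r ρ 1 β = 1 := by
  have hfin := finite_adjoinRoot_X_pow_sub_C hr (β : F)
  have hnt := nontrivial_adjoinRoot_X_pow_sub_C hr (β : F)
  have hrank := finrank_adjoinRoot_X_pow_sub_C hr (β : F)
  have h := isSymbolPair_rootTwist hr hρ.pow_eq_one (β : F)
  let e := SymbolAlgebra.equivOfPair (α := 1) (D := Module.End F _) hr hρ
    (by rw [Module.finrank_linearMap, hrank]) h
  rw [symbolClass, brauerClass_congr (e.trans (algEquivMatrix (Module.finBasis F _))),
    brauerClass_matrix (by rw [hrank]; exact hr), brauerClass_self]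

theorem symbolClass_swap (hr : r ≠ 0) (hρ : IsPrimitiveRoot ρ r) (α β : Fˣ) :
    symbolClass r ρ α β = symbolClass r ρ β α⁻¹ := by
  have h := SymbolAlgebra.isSymbolPair_gen (r := r) (ρ := ρ) (α := α) (β := β)
  obtain ⟨u, hu⟩ := h.isUnit_left hr α.ne_zero
  rw [← hu] at h
  have h' := h.swap
  rw [← Units.val_inv_eq_inv_val] at h'
  exact (symbolClass_eq_of_pair hr hρ hρ h').symm

theorem symbolClass_pow_left (hr : r ≠ 0) (hρ : IsPrimitiveRoot ρ r) (α β : Fˣ) :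
    symbolClass r ρ (α ^ r) β = 1 := by
  rw [← symbolClass_one_left hr hρ β]
  have h := (SymbolAlgebra.isSymbolPair_gen (r := r) (ρ := ρ) (α := 1) (β := β)).smul_left (α : F)
  rw [Units.val_one, mul_one, ← Units.val_pow_eq_pow_val] at h
  exact symbolClass_eq_of_pair hr hρ hρ h

theorem symbolClass_one_right (hr : r ≠ 0) (hρ : IsPrimitiveRoot ρ r) (α : Fˣ) :
    symbolClass r ρ α 1 = 1 := by
  rw [← symbolClass_one_left hr hρ α, symbolClass_swap hr hρ 1, inv_one]

/-- The Steinberg relation. -/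
theorem symbolClass_one_sub (hr : r ≠ 0) (hρ : IsPrimitiveRoot ρ r) (α β : Fˣ)
    (h : (α : F) = 1 - β) : symbolClass r ρ α β = 1 := by
  rw [← symbolClass_one_left hr hρ β]
  have hp := SymbolAlgebra.isSymbolPair_gen (r := r) (ρ := ρ) (α := 1) (β := β)
  -- The norm of 1 - y is 1 - y^r = 1 - β = α, so x (1 - y) in (1, β) is a first generator for (α,
  -- β).
  have hprod : ∏ k ∈ Finset.range r, (1 - Polynomial.X : Polynomial F).comp
      (Polynomial.C (ρ ^ k) * Polynomial.X) = 1 - Polynomial.X ^ r := by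
    have hρC : IsPrimitiveRoot (Polynomial.C ρ) r := hρ.map_of_injective Polynomial.C_injective
    have := hρC.pow_sub_pow_eq_prod_sub_mul (1 : Polynomial F) Polynomial.X (Nat.pos_of_ne_zero hr)
    rw [one_pow] at this
    rw [this]
    have : NeZero r := ⟨hr⟩
    refine Finset.prod_nbij (fun k => Polynomial.C ρ ^ k) (fun k _ => ?_) ?_ ?_ fun k _ => ?_
    · rw [Polynomial.mem_nthRootsFinset (Nat.pos_of_ne_zero hr), pow_right_comm, hρC.pow_eq_one,
        one_pow]
    · intro a ha b hb hab
      exact hρC.pow_inj (by simpa using ha) (by simpa using hb) hab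
    · intro z hz
      obtain ⟨k, hk, rfl⟩ := hρC.eq_pow_of_pow_eq_one
        ((Polynomial.mem_nthRootsFinset (Nat.pos_of_ne_zero hr) _).1 hz)
      exact ⟨k, by simpa using hk, rfl⟩
    · simp
  have h' := hp.mul_aeval (1 - Polynomial.X) (c := (α : F)) (by
    rw [hprod, map_sub, map_one, map_pow, Polynomial.aeval_X, hp.pow_right, h, map_sub, map_one])
  rw [Units.val_one, one_mul] at h'
  exact symbolClass_eq_of_pair hr hρ hρ h'

/-- In (1, β) the r-th power of x y is β ∏ ρ^k. Dividing x y by c removes the sign. -/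
theorem symbolClass_self (hr : r ≠ 0) (hρ : IsPrimitiveRoot ρ r)
    (hc : ∃ c : F, c ^ r = ∏ k ∈ Finset.range r, ρ ^ k) (β : Fˣ) :
    symbolClass r ρ β β = 1 := by
  obtain ⟨c, hc⟩ := hc
  have hc0 : c ≠ 0 := by
    rintro rfl
    rw [zero_pow hr, eq_comm, Finset.prod_eq_zero_iff] at hc
    obtain ⟨k, -, hk⟩ := hc
    exact pow_ne_zero k (hρ.ne_zero hr) hk
  rw [← symbolClass_one_left hr hρ β]
  have hp := SymbolAlgebra.isSymbolPair_gen (r := r) (ρ := ρ) (α := 1) (β := β)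
  have h' := (hp.mul_aeval Polynomial.X (c := c ^ r * (β : F)) (by
    simp only [Polynomial.X_comp]
    rw [Finset.prod_mul_distrib, Finset.prod_const, Finset.card_range, map_mul, map_pow,
      Polynomial.aeval_X, hp.pow_right, ← map_prod, Polynomial.aeval_C, hc, map_mul])).smul_left c⁻¹
  rw [Units.val_one, one_mul, ← mul_assoc, ← mul_pow, inv_mul_cancel₀ hc0, one_pow, one_mul] at h'
  exact symbolClass_eq_of_pair hr hρ hρ h'

/-- With ρ' = ρ^l, the pair x, y^l satisfies the relations for ρ'. -/
theorem symbolClass_root_change {ρ' : F} (hr : r ≠ 0) (hρ : IsPrimitiveRoot ρ r)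
    (hρ' : IsPrimitiveRoot ρ' r) : ∃ l : ℕ, ∀ α β : Fˣ,
    symbolClass r ρ α β = symbolClass r ρ' α (β ^ l) := by
  have : NeZero r := ⟨hr⟩
  obtain ⟨l, -, hl⟩ := hρ.eq_pow_of_pow_eq_one hρ'.pow_eq_one
  refine ⟨l, fun α β => ?_⟩
  have hp := SymbolAlgebra.isSymbolPair_gen (r := r) (ρ := ρ) (α := α) (β := β)
  refine (symbolClass_eq_of_pair (x := SymbolAlgebra.genI r ρ α β)
    (y := SymbolAlgebra.genJ r ρ α β ^ l) hr hρ' hρ ⟨hp.pow_left, ?_, ?_⟩).symm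
  · rw [← pow_mul, mul_comm, pow_mul, hp.pow_right, Units.val_pow_eq_pow_val, map_pow]
  · simpa [hl] using hp.right_pow_mul_left_pow 1 l

theorem symbolClass_mul_left (hr : r ≠ 0) (hρ : IsPrimitiveRoot ρ r) (α α' β : Fˣ) :
    symbolClass r ρ (α * α') β = symbolClass r ρ α β * symbolClass r ρ α' β := by
  -- The split factor (α', 1) makes the dimensions agree: the isomorphism is (α α', β) ⊗ (α', 1) ≅
  -- (α, β) ⊗ (α', β), given by the commuting pairs x ⊗ x', y ⊗ 1 and 1 ⊗ x', y⁻¹ ⊗ y'.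
  rw [← mul_one (symbolClass r ρ (α * α') β), ← symbolClass_one_right hr hρ α', symbolClass,
    symbolClass, ← brauerClass_tensor, symbolClass, symbolClass, ← brauerClass_tensor]
  have h := SymbolAlgebra.isSymbolPair_gen (r := r) (ρ := ρ) (α := α) (β := β)
  have h' := SymbolAlgebra.isSymbolPair_gen (r := r) (ρ := ρ) (α := α') (β := β)
  set x := SymbolAlgebra.genI r ρ α β
  set x' := SymbolAlgebra.genI r ρ α' β
  set y' := SymbolAlgebra.genJ r ρ α' β
  obtain ⟨y, hy⟩ := h.isUnit_right hr β.ne_zero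
  have hyx : ((y⁻¹ : (SymbolAlgebra r ρ α β)ˣ) : SymbolAlgebra r ρ α β) * x =
      ρ⁻¹ • (x * (y⁻¹ : (SymbolAlgebra r ρ α β)ˣ)) := by
    rw [Units.inv_mul_eq_iff_eq_mul, mul_smul_comm, ← mul_assoc, hy, h.comm, smul_mul_assoc,
      smul_smul, inv_mul_cancel₀ (hρ.ne_zero hr), one_smul, mul_assoc, ← hy, Units.mul_inv, mul_one]
  have p₁ : IsSymbolPair r ρ ((α * α' : Fˣ) : F) (β : F) (x ⊗ₜ[F] x')
      ((y : SymbolAlgebra r ρ α β) ⊗ₜ[F] (1 : SymbolAlgebra r ρ α' β)) := by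
    rw [hy, Units.val_mul]
    exact h.tmul h'.pow_left
  have p₂ : IsSymbolPair r ρ (α' : F) ((1 : Fˣ) : F) ((1 : SymbolAlgebra r ρ α β) ⊗ₜ[F] x')
      (((y⁻¹ : (SymbolAlgebra r ρ α β)ˣ) : SymbolAlgebra r ρ α β) ⊗ₜ[F] y') := by
    refine ⟨?_, ?_, ?_⟩
    · rw [Algebra.TensorProduct.tmul_pow, one_pow, h'.pow_left, Algebra.algebraMap_eq_smul_one,
        TensorProduct.tmul_smul]
      exact (Algebra.algebraMap_eq_smul_one _).symm
    · rw [Algebra.TensorProduct.tmul_pow, h'.pow_right,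
        units_inv_pow_eq_algebraMap (hy ▸ h.pow_right), Algebra.algebraMap_eq_smul_one,
        Algebra.algebraMap_eq_smul_one, TensorProduct.smul_tmul_smul, inv_mul_cancel₀ β.ne_zero,
        one_smul, Units.val_one, map_one, Algebra.TensorProduct.one_def]
    · rw [Algebra.TensorProduct.tmul_mul_tmul, Algebra.TensorProduct.tmul_mul_tmul, h'.comm,
        one_mul, mul_one, TensorProduct.tmul_smul]
  have hcomm : ∀ a b, Commute (SymbolAlgebra.lift p₁ a) (SymbolAlgebra.lift p₂ b) := by
    refine SymbolAlgebra.commute_lift hr p₁ p₂ ?_ ?_ ?_ ?_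
    · exact (Commute.one_right x).tmul (Commute.refl x')
    · rw [Commute, SemiconjBy, Algebra.TensorProduct.tmul_mul_tmul,
        Algebra.TensorProduct.tmul_mul_tmul, h'.comm, hyx, TensorProduct.smul_tmul_smul,
        inv_mul_cancel₀ (hρ.ne_zero hr), one_smul]
    · exact (Commute.one_right _).tmul (Commute.one_left _)
    · exact (Commute.refl y).inv_right.units_val.tmul (Commute.one_left _)
  let f := Algebra.TensorProduct.lift _ _ hcomm
  have hf₁ : ∀ a, f (a ⊗ₜ 1) = SymbolAlgebra.lift p₁ a := by
    intro a
    simp [f]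
  have hf₂ : ∀ b, f (1 ⊗ₜ b) = SymbolAlgebra.lift p₂ b := by
    intro b
    simp [f]
  have mx' : (1 : SymbolAlgebra r ρ α β) ⊗ₜ[F] x' ∈ f.range :=
    ⟨1 ⊗ₜ SymbolAlgebra.genI r ρ α' 1, by simp [hf₂]⟩
  have my : (y : SymbolAlgebra r ρ α β) ⊗ₜ[F] (1 : SymbolAlgebra r ρ α' β) ∈ f.range :=
    ⟨SymbolAlgebra.genJ r ρ (α * α') β ⊗ₜ 1, by simp [hf₁]⟩
  -- Cancel x' from x ⊗ x' by means of x'⁻¹ = α'⁻¹ x'^(r-1).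
  have mx : x ⊗ₜ[F] (1 : SymbolAlgebra r ρ α' β) ∈ f.range := by
    have mxx : x ⊗ₜ[F] x' ∈ f.range := ⟨SymbolAlgebra.genI r ρ (α * α') β ⊗ₜ 1, by simp [hf₁]⟩
    have := f.range.smul_mem (f.range.mul_mem mxx (f.range.pow_mem mx' (r - 1))) (α'⁻¹ : F)
    rwa [Algebra.TensorProduct.tmul_pow, Algebra.TensorProduct.tmul_mul_tmul, one_pow, mul_one,
      mul_pow_sub_one hr, h'.pow_left, Algebra.algebraMap_eq_smul_one, ← TensorProduct.tmul_smul,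
      smul_smul, inv_mul_cancel₀ α'.ne_zero, one_smul] at this
  have my' : (1 : SymbolAlgebra r ρ α β) ⊗ₜ[F] y' ∈ f.range := by
    have myy : ((y⁻¹ : (SymbolAlgebra r ρ α β)ˣ) : SymbolAlgebra r ρ α β) ⊗ₜ[F] y' ∈ f.range :=
      ⟨1 ⊗ₜ SymbolAlgebra.genJ r ρ α' 1, by simp [hf₂]⟩
    have := f.range.mul_mem my myy
    rwa [Algebra.TensorProduct.tmul_mul_tmul, Units.mul_inv, one_mul] at this
  rw [hy] at my
  have hsurj : Function.Surjective f := by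
    intro z
    change z ∈ f.range
    induction z using TensorProduct.induction_on with
    | zero => exact f.range.zero_mem
    | add a b ha hb => exact f.range.add_mem ha hb
    | tmul a b =>
      have ha := SymbolAlgebra.algHom_mem hr (Algebra.TensorProduct.includeLeft (R := F) (S := F)
        (A := SymbolAlgebra r ρ α β) (B := SymbolAlgebra r ρ α' β)) f.range mx my a
      have hb := SymbolAlgebra.algHom_mem hr (Algebra.TensorProduct.includeRight (R := F)
        (A := SymbolAlgebra r ρ α β) (B := SymbolAlgebra r ρ α' β)) f.range mx' my' b
      simpa using f.range.mul_mem ha hb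
  have := fun α β => SymbolAlgebra.finite (F := F) hr (ρ := ρ) (α := α) (β := β)
  exact brauerClass_congr (AlgEquiv.ofBijective f
    ⟨(LinearMap.injective_iff_surjective_of_finrank_eq_finrank (f := f.toLinearMap) (by
      simp [Module.finrank_tensorProduct, SymbolAlgebra.finrank_eq hr hρ])).2 hsurj, hsurj⟩)

theorem pow_half_eq_neg_one {ζ : F} {k : ℕ} (hk : k ≠ 0) (hζ : IsPrimitiveRoot ζ (2 * k)) :
    ζ ^ k = -1 := by
  have h1 : ζ ^ k * ζ ^ k = 1 := by rw [← pow_add, ← two_mul, hζ.pow_eq_one]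
  rcases mul_self_eq_one_iff.1 h1 with h | h
  · exact absurd h (hζ.pow_ne_one_of_pos_of_lt hk (by omega))
  · exact h

/-- Index reduction for symbols with a square slot. -/
theorem symbolClass_sq_right {M : ℕ} (hM : M ≠ 0) (hρ : IsPrimitiveRoot ρ (2 * M)) (α β : Fˣ) :
    symbolClass (2 * M) ρ α (β ^ 2) = symbolClass M (ρ ^ 2) α β := by
  have hρ2 : IsPrimitiveRoot (ρ ^ 2) M := hρ.pow (by omega) rfl
  have hneg := pow_half_eq_neg_one hM hρ
  have h := SymbolAlgebra.isSymbolPair_gen (r := M) (ρ := ρ ^ 2) (α := α) (β := β)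
  have hnt := SymbolAlgebra.nontrivial (α := α) (β := β) hM hρ2.pow_eq_one
  have hfin := SymbolAlgebra.finite (F := F) hM (ρ := ρ ^ 2) (α := α) (β := β)
  have hp := h.matrix hneg
  rw [← Units.val_pow_eq_pow_val] at hp
  rw [symbolClass, brauerClass_congr (SymbolAlgebra.equivOfPair (by omega) hρ (by
    rw [Module.finrank_matrix, SymbolAlgebra.finrank_eq hM hρ2]; simp; ring) hp),
    brauerClass_matrix two_ne_zero]
  rfl

end SymbolClass

/-! ### The invariant of a tuple attached to a symbol -/

section Symbol

variable {F G : Type*} [Field F] [CommGroup G] (σ : Fˣ →* Fˣ →* G)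

/-- The product `∏ (b_{2i} P_{2i-1}, b_{2i+1} P_{2i-1})` over `1 ≤ i ≤ n`, where
`P_k = b_1 ⋯ b_k`; here the sequence `b` is indexed from zero. -/
def cliffordInvariant (n : ℕ) (b : ℕ → Fˣ) : G :=
  ∏ i ∈ Finset.range n, σ (b (2 * i + 1) * ∏ j ∈ Finset.range (2 * i + 1), b j)
    (b (2 * i + 2) * ∏ j ∈ Finset.range (2 * i + 1), b j)

theorem prod_range_of_eq_off {N i : ℕ} {b b' : ℕ → Fˣ} {u : Fˣ} (hi : b' i = u * b i)
    (hb : ∀ k, k ≠ i → b' k = b k) :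
    ∏ j ∈ Finset.range N, b' j = (if i < N then u else 1) * ∏ j ∈ Finset.range N, b j := by
  have : ∀ j, b' j = (if j = i then u else 1) * b j := by
    intro j
    split_ifs with h
    · rw [h, hi]
    · rw [hb j h, one_mul]
  simp only [this, Finset.prod_mul_distrib]
  simp

theorem cliffordInvariant_congr {n : ℕ} {b b' : ℕ → Fˣ} (h : ∀ k < 2 * n + 1, b k = b' k) :
    cliffordInvariant σ n b = cliffordInvariant σ n b' := by
  refine Finset.prod_congr rfl fun i hi => ?_
  rw [Finset.mem_range] at hi
  have : ∏ j ∈ Finset.range (2 * i + 1), b j = ∏ j ∈ Finset.range (2 * i + 1), b' j :=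
    Finset.prod_congr rfl fun j hj => h j (by rw [Finset.mem_range] at hj; omega)
  rw [this, h _ (by omega), h _ (by omega)]

variable {σ}

/-- Expand σ(ab, ab) = 1. -/
theorem symbol_swap (halt : ∀ a, σ a a = 1) (a b : Fˣ) : σ a b = σ b a⁻¹ := by
  have h := halt (a * b)
  simp only [map_mul, MonoidHom.mul_apply, halt, one_mul, mul_one] at h
  rw [map_inv, eq_inv_iff_mul_eq_one, mul_comm, h]

/-- The change of the invariant under a change of one entry. -/
theorem cliffordInvariant_change (halt : ∀ a, σ a a = 1) {n i : ℕ} (hi : i < 2 * n + 1)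
    {b b' : ℕ → Fˣ} {u : Fˣ} (hbi : b' i = u * b i) (hb : ∀ k, k ≠ i → b' k = b k) :
    ∃ t : Fˣ, cliffordInvariant σ n b' =
      cliffordInvariant σ n b * σ u (t ^ 2 * (∏ j ∈ Finset.range (2 * n + 1), b j) * b i) := by
  induction n with
  | zero =>
    obtain rfl : i = 0 := by omega
    refine ⟨(b 0)⁻¹, ?_⟩
    have : (b 0)⁻¹ ^ 2 * (∏ j ∈ Finset.range (2 * 0 + 1), b j) * b 0 = 1 := by
      rw [Finset.prod_range_one]
      group
    rw [this, map_one, mul_one]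
    rfl
  | succ n ih =>
    have hstep : ∀ c : ℕ → Fˣ, cliffordInvariant σ (n + 1) c = cliffordInvariant σ n c *
        σ (c (2 * n + 1) * ∏ j ∈ Finset.range (2 * n + 1), c j)
          (c (2 * n + 2) * ∏ j ∈ Finset.range (2 * n + 1), c j) :=
      fun c => Finset.prod_range_succ _ _
    rw [hstep, hstep, prod_range_of_eq_off hbi hb, show 2 * (n + 1) + 1 = 2 * n + 1 + 1 + 1 by ring,
      Finset.prod_range_succ _ (2 * n + 1 + 1), Finset.prod_range_succ _ (2 * n + 1)]
    generalize hP : ∏ j ∈ Finset.range (2 * n + 1), b j = P at ih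
    rcases lt_or_ge i (2 * n + 1) with h | h
    · obtain ⟨t, ht⟩ := ih h
      -- Here only P changes in the new factor (xP, yP). Replacing P by uP contributes (u, y/x),
      -- which agrees with (u, xy) up to the square x⁻².
      refine ⟨t * (b (2 * n + 1))⁻¹, ?_⟩
      rw [ht, if_pos h, hb _ (by omega), hb _ (by omega)]
      generalize b (2 * n + 1) = x
      generalize b (2 * n + 1 + 1) = y
      generalize b i = z
      generalize cliffordInvariant σ n b = K
      have hx : σ x u = (σ u x)⁻¹ := by rw [symbol_swap halt, map_inv]
      have hP : σ P u = (σ u P)⁻¹ := by rw [symbol_swap halt, map_inv]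
      simp only [map_mul, map_pow, map_inv, MonoidHom.mul_apply, halt, one_mul, hx, hP]
      apply Additive.ofMul.injective
      simp only [ofMul_mul, ofMul_pow, ofMul_inv]
      abel
    · rw [if_neg (by omega), one_mul, cliffordInvariant_congr σ (b := b') (b' := b)
        (fun k hk => hb k (by omega))]
      rcases h.eq_or_lt with rfl | h'
      · refine ⟨(b (2 * n + 1))⁻¹, ?_⟩
        rw [hbi, hb _ (by omega)]
        generalize b (2 * n + 1) = x
        generalize b (2 * n + 1 + 1) = y
        simp only [map_mul, map_pow, map_inv, MonoidHom.mul_apply]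
        apply Additive.ofMul.injective
        simp only [ofMul_mul, ofMul_pow, ofMul_inv]
        abel
      · obtain rfl : i = 2 * n + 2 := by omega
        rw [hbi, hb _ (by omega)]
        refine ⟨(P * b (2 * n + 1) * b (2 * n + 2))⁻¹, ?_⟩
        generalize b (2 * n + 1) = x
        generalize b (2 * n + 2) = y
        have hx : σ x u = (σ u x)⁻¹ := by rw [symbol_swap halt, map_inv]
        have hP : σ P u = (σ u P)⁻¹ := by rw [symbol_swap halt, map_inv]
        simp only [map_mul, map_pow, map_inv, MonoidHom.mul_apply, hx, hP]
        apply Additive.ofMul.injective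
        simp only [ofMul_mul, ofMul_pow, ofMul_inv]
        abel

theorem cliffordInvariant_full (halt : ∀ a, σ a a = 1) {n i : ℕ}
    {b b' : ℕ → Fˣ} {c : Fˣ} (hbi : b' i = c ^ 2 * b i) (hb : ∀ k, k ≠ i → b' k = b k) :
    ∃ x y : Fˣ, cliffordInvariant σ n b' = cliffordInvariant σ n b * σ x (y ^ 2) := by
  rcases lt_or_ge i (2 * n + 1) with hi | hi
  · obtain ⟨t, ht⟩ := cliffordInvariant_change halt hi hbi hb
    -- Moves the exponent 2: (c², z) = (c, z²).
    refine ⟨c, t ^ 2 * (∏ j ∈ Finset.range (2 * n + 1), b j) * b i, ?_⟩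
    rw [ht, map_pow, MonoidHom.pow_apply, ← map_pow]
  · refine ⟨1, 1, ?_⟩
    rw [map_one, MonoidHom.one_apply, mul_one]
    exact cliffordInvariant_congr σ fun k hk => hb k (by omega)

theorem cliffordInvariant_dashed (halt : ∀ a, σ a a = 1) (hneg : ∀ a, σ a (-1) = 1)
    (hst : ∀ a b : Fˣ, (a : F) = 1 - b → σ a b = 1) {n i j : ℕ} (hij : i < j)
    (hj : j < 2 * n + 2) {b b' : ℕ → Fˣ} {u : Fˣ} (hu : (u : F) = 1 + (b j : F) / (b i : F))
    (hbi : b' i = u * b i) (hbj : b' j = u * b j) (hb : ∀ k, k ≠ i → k ≠ j → b' k = b k)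
    (hsq : IsSquare (∏ k ∈ Finset.range (2 * n + 2), b k)) :
    ∃ x y : Fˣ, cliffordInvariant σ n b' = cliffordInvariant σ n b * σ x (y ^ 2) := by
  -- Steinberg for u = 1 - (-b_j/b_i), with the sign absorbed by `hneg`.
  have hu' : σ u (b j) = σ u (b i) := by
    have h : σ u (-1 * (b j * (b i)⁻¹)) = 1 := hst _ _ (by
      rw [hu]
      push_cast
      rw [div_eq_mul_inv]
      ring)
    rw [map_mul, hneg, one_mul, map_mul, map_inv, mul_inv_eq_one] at h
    exact h
  -- The dashed step is split into two changes of a single entry.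
  let b₁ := Function.update b i (u * b i)
  have hb₁i : b₁ i = u * b i := Function.update_self _ _ _
  have hb₁ : ∀ k, k ≠ i → b₁ k = b k := fun k hk => Function.update_of_ne hk _ _
  obtain ⟨t, ht⟩ := cliffordInvariant_change halt (n := n) (by omega) hb₁i hb₁
  have hb'j : b' j = u * b₁ j := by rw [hbj, hb₁ j hij.ne']
  have hb' : ∀ k, k ≠ j → b' k = b₁ k := by
    intro k hk
    by_cases hki : k = i
    · rw [hki, hbi, hb₁i]
    · rw [hb₁ k hki, hb k hki hk]
  rcases lt_or_ge j (2 * n + 1) with h | h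
  · obtain ⟨s, hs⟩ := cliffordInvariant_change halt h hb'j hb'
    rw [prod_range_of_eq_off hb₁i hb₁, if_pos (by omega), hb₁ j hij.ne', ht] at hs
    generalize ∏ j ∈ Finset.range (2 * n + 1), b j = P at hs
    -- The total change is (u, t² P b_i · s² u P b_j). The second change already sees uP; the extra
    -- u drops out by (u, u) = 1, and b_j may be replaced by b_i.
    refine ⟨u, t * s * P * b i, ?_⟩
    rw [hs]
    simp only [map_mul, map_pow, halt, hu', one_mul]
    apply Additive.ofMul.injective
    simp only [ofMul_mul, ofMul_pow]
    abel
  -- The last slot is invisible to the invariant. Since P b_j = y², the single change (u, t² P b_i)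
  -- equals (u, t² P b_j) = (u, (t y)²).
  · obtain rfl : j = 2 * n + 1 := by omega
    rw [← cliffordInvariant_congr σ (b := b') (b' := b₁) fun k hk => hb' k (by omega)] at ht
    obtain ⟨y, hy⟩ := hsq
    rw [Finset.prod_range_succ] at hy
    generalize ∏ j ∈ Finset.range (2 * n + 1), b j = P at ht hy
    refine ⟨u, t * y, ?_⟩
    rw [ht, eq_mul_inv_of_mul_eq hy]
    simp only [map_mul, map_pow, map_inv, hu']
    apply Additive.ofMul.injective
    simp only [ofMul_mul, ofMul_pow, ofMul_inv]
    abel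

end Symbol

/-! ### Chains of steps -/

section Chain

variable {F G : Type*} [Field F] [CommGroup G]

/-- Extension of a finite tuple by ones. -/
def extendOne {N : ℕ} (b : Fin N → Fˣ) (k : ℕ) : Fˣ := if h : k < N then b ⟨k, h⟩ else 1

theorem extendOne_apply {N : ℕ} (b : Fin N → Fˣ) {k : ℕ} (h : k < N) :
    extendOne b k = b ⟨k, h⟩ := dif_pos h

theorem prod_range_extendOne {N : ℕ} (b : Fin N → Fˣ) :
    ∏ k ∈ Finset.range N, extendOne b k = ∏ k, b k := by
  rw [← Fin.prod_univ_eq_prod_range]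
  exact Finset.prod_congr rfl fun k _ => extendOne_apply b k.2

theorem extendOne_eq_off {N : ℕ} {b b' : Fin N → Fˣ} {P : ℕ → Prop}
    (h : ∀ k : Fin N, P k → b' k = b k) (k : ℕ) (hk : P k) : extendOne b' k = extendOne b k := by
  unfold extendOne
  split_ifs with hN
  · exact h ⟨k, hN⟩ hk
  · rfl

theorem isSquare_mul_iff_of_isSquare_left {a x : G} (ha : IsSquare a) :
    IsSquare (a * x) ↔ IsSquare x :=
  ⟨fun h => by simpa using ha.inv.mul h, ha.mul⟩

variable {σ : Fˣ →* Fˣ →* G} {n : ℕ} {b b' : Fin (2 * n + 2) → Fˣ}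

theorem FullStep.isSquare_prod_iff (h : FullStep b b') :
    IsSquare (∏ k, b' k) ↔ IsSquare (∏ k, b k) := by
  obtain ⟨i, c, hb, hi⟩ := h
  rw [← prod_range_extendOne, ← prod_range_extendOne, prod_range_of_eq_off (b := extendOne b)
    (i := i) (u := c ^ 2) (by simpa [extendOne_apply] using hi)
    (extendOne_eq_off fun k hk => (hb k (by simpa [Fin.ext_iff] using hk)).symm), if_pos i.2]
  exact isSquare_mul_iff_of_isSquare_left (IsSquare.sq c)

/-- The common factor in a dashed step, as a unit. -/
theorem DashedStep.exists_unit (h : DashedStep b b') : ∃ (i j : Fin (2 * n + 2)) (u : Fˣ), i < j ∧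
    (u : F) = 1 + (b j : F) / (b i : F) ∧ b' i = u * b i ∧ b' j = u * b j ∧
      ∀ k, k ≠ i → k ≠ j → b' k = b k := by
  obtain ⟨i, j, hij, hb, hi, hj⟩ := h
  have hu : (1 + (b j : F) / (b i : F)) ≠ 0 := by
    intro h0
    rw [h0, zero_mul] at hi
    exact (b' i).ne_zero hi
  exact ⟨i, j, Units.mk0 _ hu, hij, rfl, Units.ext hi, Units.ext hj,
    fun k h₁ h₂ => (hb k h₁ h₂).symm⟩

theorem DashedStep.isSquare_prod_iff (h : DashedStep b b') :
    IsSquare (∏ k, b' k) ↔ IsSquare (∏ k, b k) := by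
  obtain ⟨i, j, u, hij, -, hi, hj, hb⟩ := h.exists_unit
  have : ∀ k, b' k = ((if k = i then u else 1) * (if k = j then u else 1)) * b k := by
    intro k
    by_cases hki : k = i
    · subst hki
      rw [hi, if_pos rfl, if_neg hij.ne, mul_one]
    · by_cases hkj : k = j
      · subst hkj
        rw [hj, if_pos rfl, if_neg hki, one_mul]
      · rw [if_neg hki, if_neg hkj, one_mul, one_mul, hb k hki hkj]
  simp only [this, Finset.prod_mul_distrib, Finset.prod_ite_eq', Finset.mem_univ, if_true]
  exact isSquare_mul_iff_of_isSquare_left ⟨u, rfl⟩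

theorem FullStep.cliffordInvariant (halt : ∀ a, σ a a = 1) (h : FullStep b b') :
    ∃ x y : Fˣ, cliffordInvariant σ n (extendOne b') =
      cliffordInvariant σ n (extendOne b) * σ x (y ^ 2) := by
  obtain ⟨i, c, hb, hi⟩ := h
  exact cliffordInvariant_full halt (i := i) (c := c) (by simpa [extendOne_apply] using hi)
    (extendOne_eq_off fun k hk => (hb k (by simpa [Fin.ext_iff] using hk)).symm)

theorem DashedStep.cliffordInvariant (halt : ∀ a, σ a a = 1) (hneg : ∀ a, σ a (-1) = 1)
    (hst : ∀ a b : Fˣ, (a : F) = 1 - b → σ a b = 1) (h : DashedStep b b')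
    (hsq : IsSquare (∏ k, b k)) :
    ∃ x y : Fˣ, cliffordInvariant σ n (extendOne b') =
      cliffordInvariant σ n (extendOne b) * σ x (y ^ 2) := by
  obtain ⟨i, j, u, hij, hu, hi, hj, hb⟩ := h.exists_unit
  exact cliffordInvariant_dashed halt hneg hst (i := i) (j := j) hij j.2 (u := u)
    (by simpa [extendOne_apply] using hu) (by simpa [extendOne_apply] using hi)
    (by simpa [extendOne_apply] using hj)
    (fun k h₁ h₂ => extendOne_eq_off (P := fun k => k ≠ i ∧ k ≠ j)
      (fun k hk => hb k (by simpa [Fin.ext_iff] using hk.1) (by simpa [Fin.ext_iff] using hk.2))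
      k ⟨h₁, h₂⟩)
    (by rwa [prod_range_extendOne])

theorem ChainStep.isSquare_prod_iff (h : ChainStep b b') :
    IsSquare (∏ k, b' k) ↔ IsSquare (∏ k, b k) := by
  rcases h with (h | h) | (h | h)
  exacts [h.isSquare_prod_iff, h.isSquare_prod_iff.symm, h.isSquare_prod_iff,
    h.isSquare_prod_iff.symm]

theorem ChainStep.cliffordInvariant (halt : ∀ a, σ a a = 1) (hneg : ∀ a, σ a (-1) = 1)
    (hst : ∀ a b : Fˣ, (a : F) = 1 - b → σ a b = 1) (h : ChainStep b b')
    (hsq : IsSquare (∏ k, b k)) :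
    ∃ x y : Fˣ, cliffordInvariant σ n (extendOne b) =
      σ x (y ^ 2) * cliffordInvariant σ n (extendOne b') := by
  have hsq' := h.isSquare_prod_iff.2 hsq
  have flip : (∃ x y : Fˣ, _root_.cliffordInvariant σ n (extendOne b') =
      _root_.cliffordInvariant σ n (extendOne b) * σ x (y ^ 2)) →
      ∃ x y : Fˣ, _root_.cliffordInvariant σ n (extendOne b) =
        σ x (y ^ 2) * _root_.cliffordInvariant σ n (extendOne b') := by
    rintro ⟨x, y, hxy⟩
    -- The inverse of (x, y²) is (x⁻¹, y²), so direction does not matter.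
    refine ⟨x⁻¹, y, ?_⟩
    rw [hxy, map_inv, MonoidHom.inv_apply, mul_comm (_root_.cliffordInvariant σ n _),
      inv_mul_cancel_left]
  have comm : (∃ x y : Fˣ, _root_.cliffordInvariant σ n (extendOne b) =
      _root_.cliffordInvariant σ n (extendOne b') * σ x (y ^ 2)) →
      ∃ x y : Fˣ, _root_.cliffordInvariant σ n (extendOne b) =
        σ x (y ^ 2) * _root_.cliffordInvariant σ n (extendOne b') := by
    rintro ⟨x, y, hxy⟩
    exact ⟨x, y, hxy.trans (mul_comm _ _)⟩
  rcases h with (h | h) | (h | h)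
  · exact flip (h.cliffordInvariant halt)
  · exact comm (h.cliffordInvariant halt)
  · exact flip (h.cliffordInvariant halt hneg hst hsq)
  · exact comm (h.cliffordInvariant halt hneg hst hsq')

theorem JoinedBySteps.cliffordInvariant (halt : ∀ a, σ a a = 1) (hneg : ∀ a, σ a (-1) = 1)
    (hst : ∀ a b : Fˣ, (a : F) = 1 - b → σ a b = 1) {r : ℕ} (h : JoinedBySteps r b b')
    (hsq : IsSquare (∏ k, b k)) :
    ∃ x y : Fin r → Fˣ, cliffordInvariant σ n (extendOne b) =
      (∏ k, σ (x k) (y k ^ 2)) * cliffordInvariant σ n (extendOne b') := by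
  obtain ⟨u, rfl, rfl, hu⟩ := h
  induction r with
  | zero => exact ⟨1, 1, by simp⟩
  | succ r ih =>
    obtain ⟨x, y, hxy⟩ := ih fun i hi => hu i (by omega)
    -- Intermediate tuples are not assumed to lie in B; squareness propagates from the start of the
    -- chain.
    have hr : ∀ k ≤ r, IsSquare (∏ i, u k i) := by
      intro k hk
      induction k with
      | zero => exact hsq
      | succ k ihk => exact (hu k (by omega)).isSquare_prod_iff.2 (ihk (by omega))
    obtain ⟨x', y', h'⟩ := (hu r (by omega)).cliffordInvariant halt hneg hst (hr r le_rfl)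
    refine ⟨Fin.snoc x x', Fin.snoc y y', ?_⟩
    rw [hxy, h', Fin.prod_univ_castSucc]
    simp [mul_assoc]

end Chain

/-! ### The maps φ and ψ and the class of C_m(ψ(b)). -/

section PhiPsi

variable {F G : Type*} [Field F] [CommGroup G] (σ : Fˣ →* Fˣ →* G) {n : ℕ}

/-- Both maps use the same prefix product, which φ divides out and ψ multiplies back. -/
theorem psi_phi (a : Fin (2 * n) → Fˣ) : psi (phi a) = a := by
  funext k
  change phiEntry a (k + 1) * ∏ j : Fin (2 * (k / 2) + 1), phiEntry a j = a k
  rw [phiEntry, dif_pos k.2, mul_assoc, ← Finset.prod_mul_distrib]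
  simp

theorem cliffordInvariant_extendOne (b : SquareTuple F n) :
    cliffordInvariant σ n (extendOne b.1) =
      ∏ i : Fin n, σ (psi b ⟨2 * i, by omega⟩) (psi b ⟨2 * i + 1, by omega⟩) := by
  rw [cliffordInvariant, ← Fin.prod_univ_eq_prod_range (fun i =>
    σ (extendOne b.1 (2 * i + 1) * ∏ j ∈ Finset.range (2 * i + 1), extendOne b.1 j)
    (extendOne b.1 (2 * i + 2) * ∏ j ∈ Finset.range (2 * i + 1), extendOne b.1 j)) n]
  have key : ∀ (k : Fin (2 * n)) (i : ℕ), (k : ℕ) / 2 = i → psi b k =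
      extendOne b.1 (k + 1) * ∏ j ∈ Finset.range (2 * i + 1), extendOne b.1 j := by
    rintro k _ rfl
    rw [psi, extendOne_apply _ (by omega), ← Fin.prod_univ_eq_prod_range]
    congr 1
    exact Finset.prod_congr rfl fun j _ => (extendOne_apply _ _).symm
  refine Finset.prod_congr rfl fun i _ => ?_
  rw [key _ (i : ℕ) (by dsimp only; omega), key _ (i : ℕ) (by dsimp only; omega)]

end PhiPsi

/-! ### The symbol with values in the units of the Brauer monoid -/

section SymbolHom

universe u

variable {F : Type u} [Field F] {r : ℕ} {ρ : F}

theorem symbolClass_mul_right (hr : r ≠ 0) (hρ : IsPrimitiveRoot ρ r) (α β β' : Fˣ) :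
    symbolClass r ρ α (β * β') = symbolClass r ρ α β * symbolClass r ρ α β' := by
  have h : ∀ β, symbolClass r ρ α β = symbolClass r ρ β⁻¹ α := fun β => by
    rw [symbolClass_swap hr hρ β⁻¹, inv_inv, symbolClass_swap hr hρ]
  rw [h, h β, h β', mul_inv, symbolClass_mul_left hr hρ]

theorem symbolClass_pow_eq_one (hr : r ≠ 0) (hρ : IsPrimitiveRoot ρ r) (α β : Fˣ) :
    symbolClass r ρ α β ^ r = 1 := by
  rw [← symbolClass_pow_left hr hρ α β]
  exact (map_pow (⟨⟨fun α => symbolClass r ρ α β, symbolClass_one_left hr hρ β⟩,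
    fun α α' => symbolClass_mul_left hr hρ α α' β⟩ : Fˣ →* BrauerMonoid F) α r).symm

/-- The symbol as a bimultiplicative map to the group of invertible Brauer classes. -/
noncomputable def symbolHom (hr : r ≠ 0) (hρ : IsPrimitiveRoot ρ r) :
    Fˣ →* Fˣ →* (BrauerMonoid F)ˣ :=
  -- A homomorphism from a group to a monoid lands in the units, so no inverse algebra has to be
  -- exhibited.
  MonoidHom.mk' (fun α => MonoidHom.toHomUnits
    { toFun := fun β => symbolClass r ρ α β
      map_one' := symbolClass_one_right hr hρ α
      map_mul' := symbolClass_mul_right hr hρ α }) fun α α' => by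
    ext β
    exact symbolClass_mul_left hr hρ α α' β

@[simp]
theorem val_symbolHom (hr : r ≠ 0) (hρ : IsPrimitiveRoot ρ r) (α β : Fˣ) :
    ((symbolHom hr hρ α β : (BrauerMonoid F)ˣ) : BrauerMonoid F) = symbolClass r ρ α β := rfl

/-- The product has square 1, hence is ±1, and -1 = ζ^(2^m). -/
theorem exists_pow_eq_prod_pow {m : ℕ} {ζ ρ : F}
    (hζ : IsPrimitiveRoot ζ (2 ^ (m + 1))) (hρ : IsPrimitiveRoot ρ (2 ^ m)) :
    ∃ c : F, c ^ (2 ^ m) = ∏ k ∈ Finset.range (2 ^ m), ρ ^ k := by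
  have hsq : (∏ k ∈ Finset.range (2 ^ m), ρ ^ k) * (∏ k ∈ Finset.range (2 ^ m), ρ ^ k) = 1 := by
    rw [Finset.prod_pow_eq_pow_sum, ← pow_add, ← mul_two, Finset.sum_range_id_mul_two, pow_mul,
      hρ.pow_eq_one, one_pow]
  rcases mul_self_eq_one_iff.1 hsq with h | h
  · exact ⟨1, by rw [h, one_pow]⟩
  · exact ⟨ζ, by rw [h, pow_half_eq_neg_one (by positivity) (pow_succ' 2 m ▸ hζ)]⟩

end SymbolHom

/-! ### The main theorem. -/

theorem mainTheorem3 {F : Type*} [Field F] (hchar : ringChar F ≠ 2) (m : ℕ) (hm : 1 ≤ m)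
    (hroot : ∃ ζ : F, IsPrimitiveRoot ζ (2 ^ (m + 1)))
    (ρ ρ' : F) (hρ : IsPrimitiveRoot ρ (2 ^ m)) (hρ' : IsPrimitiveRoot ρ' (2 ^ (m - 1)))
    (n r s : ℕ) (v : Fin (2 * n) → Fˣ) (w : SquareTuple F n)
    (hsteps : JoinedBySteps r (phi v).1 w.1)
    (hw : IsProductOfSymbols (2 ^ (m - 1)) ρ' (CliffordTensor m ρ (psi w)) s) :
    InBrauerTorsion F (2 ^ (m - 1)) (CliffordTensor m ρ v) ∧
      symbolLength (2 ^ (m - 1)) ρ' (CliffordTensor m ρ v) ≤ ((r + s : ℕ) : ℕ∞) := by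
  obtain ⟨ζ, hζ⟩ := hroot
  have hr : 2 ^ m ≠ 0 := by positivity
  have hM : 2 ^ (m - 1) ≠ 0 := by positivity
  have h2 : 2 ^ m = 2 * 2 ^ (m - 1) := by rw [← pow_succ', Nat.sub_add_cancel hm]
  have hζneg : ζ ^ 2 ^ m = -1 :=
    pow_half_eq_neg_one hr (pow_succ' 2 m ▸ hζ)
  -- Index reduction produces symbols for ρ², which need not be ρ'; the exponent l translates
  -- between the two roots.
  obtain ⟨l, hl⟩ := symbolClass_root_change hM
    (hρ.pow (by positivity) h2 : IsPrimitiveRoot (ρ ^ 2) (2 ^ (m - 1))) hρ'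
  have hred : ∀ x y : Fˣ, symbolClass (2 ^ m) ρ x (y ^ 2) =
      symbolClass (2 ^ (m - 1)) ρ' x (y ^ l) := by
    intro x y
    rw [← hl, h2, symbolClass_sq_right hM (h2 ▸ hρ)]
  have hclass : ∀ b : SquareTuple F n, (brauerClass (CliffordTensor m ρ (psi b)) : BrauerMonoid F) =
      (cliffordInvariant (symbolHom hr hρ) n (extendOne b.1) : (BrauerMonoid F)ˣ) := by
    intro b
    rw [cliffordInvariant_extendOne, brauerClass_piTensorProduct, Units.coe_prod]
    rfl
  obtain ⟨x, y, hxy⟩ := hsteps.cliffordInvariant (σ := symbolHom hr hρ)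
    (fun a => Units.ext (symbolClass_self hr hρ (exists_pow_eq_prod_pow hζ hρ) a))
    (fun a => by
      let z := Units.mk0 ζ (hζ.ne_zero (by positivity))
      have hz : (-1 : Fˣ) = z ^ 2 ^ m := Units.ext (by simp [z, hζneg])
      rw [hz, map_pow]
      exact Units.ext (symbolClass_pow_eq_one hr hρ a z))
    (fun a b hab => Units.ext (symbolClass_one_sub hr hρ a b hab)) (phi v).2
  obtain ⟨α, β, hαβ⟩ := hw
  rw [← brauerClass_eq_iff, hclass, brauerClass_piTensorProduct] at hαβ
  have hv : (brauerClass (CliffordTensor m ρ v) : BrauerMonoid F) =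
      ∏ i : Fin (r + s), symbolClass (2 ^ (m - 1)) ρ' (Fin.append x α i)
        (Fin.append (fun k => y k ^ l) β i) := by
    rw [← psi_phi v, hclass, hxy, Units.val_mul, hαβ, Units.coe_prod, Fin.prod_univ_add]
    simp only [Fin.append_left, Fin.append_right, val_symbolHom, hred]
    rfl
  constructor
  · rw [InBrauerTorsion, ← brauerClass_eq_iff, brauerClass_piTensorProduct, Finset.prod_const,
      Finset.card_univ, Fintype.card_fin, hv, ← Finset.prod_pow, brauerClass_self]
    exact Finset.prod_eq_one fun i _ => symbolClass_pow_eq_one hM hρ' _ _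
  · refine iInf₂_le_of_le (r + s) ⟨Fin.append x α, Fin.append (fun k => y k ^ l) β,
      brauerClass_eq_iff.1 ?_⟩ le_rfl
    rw [hv, brauerClass_piTensorProduct]
    rfl
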